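/- Let $X$ be a Banach space, $U$ a normed space (both over $\mathbb R$ or both over $\mathbb C$), let $A:D(A)\subset X\to X$ be the infinitesimal generator of a strongly continuous semigroup $T=(T(t))_{t\ge 0}$ on $X$, let $B:U\to X$ be a bounded linear operator, and let $C:X\times U\to X$ be such that: (a) for every $r>0$ there is $L>0$ with $\|C(y,v)-C(x,v)\|_X\le L\|y-x\|_X$ whenever $\|x\|_X,\|y\|_X,\|v\|_U<r$; (b) $C(x,\cdot)$ is continuous for every $x\in X$; (c) there is $\xi\in\mathcal K$ with $\|C(x,v)\|_X\le\|x\|_X\,\xi(\|v\|_U)$ for all $x\in X$, $v\in U$. Let $\mathcal U:=PC_b(\mathbb R_+,U)$ be the space of bounded, piecewise continuous, right-continuous functions $u:\mathbb R_+\to U$ with $\|u\|_{\mathcal U}=\sup_{s\ge 0}\|u(s)\|_U$, and consider the generalized bilinear system $$\dot x(t)=Ax(t)+Bu(t)+C(x(t),u(t)),\qquad x(0)=x_0,\quad u\in\mathcal U,$$ in the mild sense: $x\in C(\mathbb R_+,X)$ and $x(t)=T(t)x_0+\int_0^tT(t-s)\big(Bu(s)+C(x(s),u(s))\big)\,ds$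 for all $t\ge 0$. Here $\mathcal{PD}$ is the class of continuous $\gamma:\mathbb R_+\to\mathbb R_+$ with $\gamma(0)=0$ and $\gamma(r)>0$ for $r>0$; $\mathcal K$ is the class of strictly increasing functions in $\mathcal{PD}$; $\mathcal K_\infty$ is the class of unbounded functions in $\mathcal K$; $\mathcal{KL}$ is the class of continuous $\beta:\mathbb R_+\times\mathbb R_+\to\mathbb R_+$ such that $\beta(\cdot,t)\in\mathcal K$ for all $t\ge0$ and, for all $r>0$, $\beta(r,\cdot)$ is strictly decreasing with limit $0$ at infinity. Then for every $x_0\in X$ and $u\in\mathcal U$ there is a unique mild solution $\phi(\cdot,x_0,u)$ on $\mathbb R_+$, and the following statements are equivalent: (i) The system is strongly iISS, i.e. it is iISS (see (ii)) and ISS with respect to small inputs: there are $\beta\in\mathcal{KL}$, $\gamma\in\mathcal K_\infty$ and $R>0$ such that $\|\phi(t,x,u)\|_X\le\beta(\|x\|_X,t)+\gamma(\|u\|_{\mathcal U})$ for all $x\in X$, all $u\in\mathcal U$ with $\|u\|_{\mathcal U}\le R$, and all $t\ge0$. (ii) The system is iISS: there are $\theta\in\mathcal K_\infty$, $\mu\in\mathcal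 K$ and $\beta\in\mathcal{KL}$ such that $\|\phi(t,x,u)\|_X\le\beta(\|x\|_X,t)+\theta\big(\int_0^t\mu(\|u(s)\|_U)\,ds\big)$ for all $t\ge0$, $x\in X$, $u\in\mathcal U$. (iii) The system is 0-UGAS: there is $\beta\in\mathcal{KL}$ such that $\|\phi(t,x,0)\|_X\le\beta(\|x\|_X,t)$ for all $x\in X$, $t\ge0$. (iv) The semigroup $T$ generated by $A$ is exponentially stable: there are $M,\lambda>0$ with $\|T(t)\|\le Me^{-\lambda t}$ for all $t\ge0$. (v) For every $x\in X$ the integral $\int_0^\infty\|T(t)x\|_X^2\,dt$ is finite, and $W:X\to\mathbb R_+$, $W(x)=\ln\big(1+\int_0^\infty\|T(t)x\|_X^2\,dt\big)$, is a non-coercive iISS Lyapunov function: $W$ is continuous and there are $\psi_2\in\mathcal K_\infty$, $\alpha\in\mathcal{PD}$ and $\sigma\in\mathcal K$ such that $0<W(x)\le\psi_2(\|x\|_X)$ for all $x\ne0$ and $$\limsup_{h\to0+}\frac{W(\phi(h,x,u))-W(x)}{h}\le-\alpha(\|x\|_X)+\sigma(\|u(0)\|_U)\qquad\text{for all }x\in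 X,\ u\in\mathcal U.$$ -/

import Mathlib

open Set Filter Topology MeasureTheory

/-! ### Comparison functions

A function on `[0, ∞)` is represented by a function on `ℝ`; only its restriction to `[0, ∞)`
is constrained and used. -/

/-- Class `PD`: continuous positive definite functions on `[0, ∞)`. -/
def IsClassPD (γ : ℝ → ℝ) : Prop :=
  ContinuousOn γ (Ici 0) ∧ γ 0 = 0 ∧ ∀ r, 0 < r → 0 < γ r

/-- Class `K`: strictly increasing functions of class `PD`. -/
def IsClassK (γ : ℝ → ℝ) : Prop :=
  IsClassPD γ ∧ StrictMonoOn γ (Ici 0)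

/-- Class `K_∞`: unbounded functions of class `K`. -/
def IsClassKInf (γ : ℝ → ℝ) : Prop :=
  IsClassK γ ∧ ∀ c : ℝ, ∃ r, 0 ≤ r ∧ c < γ r

/-- Class `L`: continuous functions on `[0, ∞)` strictly decreasing to `0`. -/
def IsClassL (γ : ℝ → ℝ) : Prop :=
  ContinuousOn γ (Ici 0) ∧ StrictAntiOn γ (Ici 0) ∧ Tendsto γ atTop (𝓝 0)

/-- Class `KL`. -/
def IsClassKL (β : ℝ → ℝ → ℝ) : Prop :=
  ContinuousOn (Function.uncurry β) (Ici 0 ×ˢ Ici 0) ∧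
    (∀ t, 0 ≤ t → IsClassK (fun r => β r t)) ∧
    (∀ r, 0 < r → IsClassL (β r))

/-! ### The input space `PC_b(ℝ₊, U)` -/

/-- `u` (restricted to `[0, ∞)`) is bounded, piecewise continuous (on every bounded interval only
finitely many discontinuities, at which one-sided limits exist) and right-continuous.
The values of `u` at negative times play no role. -/
structure IsPCb {U : Type*} [NormedAddCommGroup U] (u : ℝ → U) : Prop where
  right_continuous : ∀ s, 0 ≤ s → ContinuousWithinAt u (Ici s) s
  left_limit : ∀ s, 0 < s → ∃ l, Tendsto u (𝓝[<] s) (𝓝 l)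
  finite_discontinuities : ∀ τ, {s | 0 < s ∧ s ≤ τ ∧ ¬ ContinuousAt u s}.Finite
  bounded : ∃ K, ∀ s, 0 ≤ s → ‖u s‖ ≤ K

/-- The supremum norm `sup_{s ≥ 0} ‖u s‖` of an input. -/
noncomputable def pcbNorm {U : Type*} [NormedAddCommGroup U] (u : ℝ → U) : ℝ :=
  ⨆ s : Ici (0 : ℝ), ‖u s‖

/-! ### Stability notions for a transition map

`φ t x u` is the state at time `t ≥ 0` of the trajectory which starts at `x` and is subject to
the input `u ∈ PC_b(ℝ₊, U)`. -/

section Stability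

variable {X U : Type*} [NormedAddCommGroup X] [NormedAddCommGroup U]

/-- Integral input-to-state stability. -/
def IsIISS (φ : ℝ → X → (ℝ → U) → X) : Prop :=
  ∃ θ μ : ℝ → ℝ, ∃ β : ℝ → ℝ → ℝ, IsClassKInf θ ∧ IsClassK μ ∧ IsClassKL β ∧
    ∀ (t : ℝ) (x : X) (u : ℝ → U), 0 ≤ t → IsPCb u →
      ‖φ t x u‖ ≤ β ‖x‖ t + θ (∫ s in (0 : ℝ)..t, μ ‖u s‖)

/-- Input-to-state stability with respect to small inputs. -/
def IsISSSmallInputs (φ : ℝ → X → (ℝ → U) → X) : Prop :=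
  ∃ β : ℝ → ℝ → ℝ, ∃ γ : ℝ → ℝ, ∃ R : ℝ, IsClassKL β ∧ IsClassKInf γ ∧ 0 < R ∧
    ∀ (x : X) (u : ℝ → U), IsPCb u → pcbNorm u ≤ R → ∀ t, 0 ≤ t →
      ‖φ t x u‖ ≤ β ‖x‖ t + γ (pcbNorm u)

/-- Strong integral input-to-state stability. -/
def IsStronglyIISS (φ : ℝ → X → (ℝ → U) → X) : Prop :=
  IsIISS φ ∧ IsISSSmallInputs φ

/-- Uniform global asymptotic stability at zero (with the zero input). -/
def IsZeroUGAS (φ : ℝ → X → (ℝ → U) → X) : Prop :=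
  ∃ β : ℝ → ℝ → ℝ, IsClassKL β ∧ ∀ (x : X) (t : ℝ), 0 ≤ t → ‖φ t x 0‖ ≤ β ‖x‖ t

/-- The Lie derivative `limsup_{h → 0+} (V (φ h x u) - V x) / h`, with values in `[-∞, ∞]`. -/
noncomputable def lieDerivative (φ : ℝ → X → (ℝ → U) → X) (V : X → ℝ) (x : X) (u : ℝ → U) :
    EReal :=
  limsup (fun h : ℝ => (((V (φ h x u) - V x) / h : ℝ) : EReal)) (𝓝[>] 0)

/-- Non-coercive iISS Lyapunov functions. -/
def IsNoncoerciveIISSLyapunov (φ : ℝ → X → (ℝ → U) → X) (V : X → ℝ) : Prop :=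
  Continuous V ∧ (∀ x, 0 ≤ V x) ∧
    ∃ ψ₂ α σ : ℝ → ℝ, IsClassKInf ψ₂ ∧ IsClassPD α ∧ IsClassK σ ∧
      (∀ x, x ≠ 0 → 0 < V x ∧ V x ≤ ψ₂ ‖x‖) ∧
      ∀ (x : X) (u : ℝ → U), IsPCb u →
        lieDerivative φ V x u ≤ ((-α ‖x‖ + σ ‖u 0‖ : ℝ) : EReal)

end Stability

/-! ### Strongly continuous semigroups -/

/-- A strongly continuous semigroup `(T t)_{t ≥ 0}` of bounded linear operators on `X`.
The values `T t` with `t < 0` play no role. -/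
structure C0Semigroup (𝕜 X : Type*) [RCLike 𝕜] [NormedAddCommGroup X] [NormedSpace 𝕜 X] where
  toFun : ℝ → X →L[𝕜] X
  map_zero : toFun 0 = ContinuousLinearMap.id 𝕜 X
  map_add : ∀ s t, 0 ≤ s → 0 ≤ t → toFun (s + t) = (toFun s).comp (toFun t)
  strong_continuity : ∀ x, Tendsto (fun t => toFun t x) (𝓝[>] 0) (𝓝 x)

instance {𝕜 X : Type*} [RCLike 𝕜] [NormedAddCommGroup X] [NormedSpace 𝕜 X] :
    CoeFun (C0Semigroup 𝕜 X) (fun _ => ℝ → X →L[𝕜] X) :=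
  ⟨C0Semigroup.toFun⟩

section Systems

variable {𝕜 X U : Type*} [RCLike 𝕜] [NormedAddCommGroup X] [NormedSpace 𝕜 X] [NormedSpace ℝ X]
  [NormedAddCommGroup U] [NormedSpace 𝕜 U]

/-- `A : D(A) ⊆ X → X` is the infinitesimal generator of `T`: `D(A)` is the set of all `x` for
which `(T h x - x) / h` converges as `h → 0+`, and `A x` is the limit. -/
def C0Semigroup.IsGenerator (T : C0Semigroup 𝕜 X) (A : X →ₗ.[𝕜] X) : Prop :=
  (∀ x : X, x ∈ A.domain ↔ ∃ y, Tendsto (fun h : ℝ => h⁻¹ • (T h x - x)) (𝓝[>] 0) (𝓝 y)) ∧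
    ∀ x : A.domain, Tendsto (fun h : ℝ => h⁻¹ • (T h (x : X) - (x : X))) (𝓝[>] 0) (𝓝 (A x))

/-- Exponential stability of a semigroup. -/
def C0Semigroup.IsExponentiallyStable (T : C0Semigroup 𝕜 X) : Prop :=
  ∃ M lam : ℝ, 0 < M ∧ 0 < lam ∧ ∀ t, 0 ≤ t → ‖T t‖ ≤ M * Real.exp (-lam * t)

/-- `f` is Lipschitz continuous in the state on bounded sets, and continuous in the input value. -/
def IsAdmissibleNonlinearity (f : X → U → X) : Prop :=
  (∀ r : ℝ, 0 < r → ∃ L : ℝ, 0 < L ∧ ∀ (x y : X) (v : U), ‖x‖ < r → ‖y‖ < r → ‖v‖ < r →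
      ‖f y v - f x v‖ ≤ L * ‖y - x‖) ∧
    ∀ x, Continuous (f x)

/-- `z` is a mild solution on `[0, ∞)` of `ẋ = A x + f (x, u)`, where `A` generates `T`. -/
def IsMildSolution (T : C0Semigroup 𝕜 X) (f : X → U → X) (u : ℝ → U) (z : ℝ → X) : Prop :=
  ContinuousOn z (Ici 0) ∧ ∀ t, 0 ≤ t →
    IntervalIntegrable (fun s => T (t - s) (f (z s) (u s))) volume 0 t ∧
      z t = T t (z 0) + ∫ s in (0 : ℝ)..t, T (t - s) (f (z s) (u s))

/-- All mild solutions with inputs in `PC_b(ℝ₊, U)` exist on `[0, ∞)` and are unique. -/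
def IsForwardComplete (T : C0Semigroup 𝕜 X) (f : X → U → X) : Prop :=
  ∀ (x : X) (u : ℝ → U), IsPCb u → ∃ z, (IsMildSolution T f u z ∧ z 0 = x) ∧
    ∀ z', IsMildSolution T f u z' → z' 0 = x → EqOn z' z (Ici 0)

open Classical in
/-- The transition map: `mildFlow T f t x u` is the value at time `t` of the mild solution which
starts at `x` and is subject to the input `u` (and `0` if there is no such solution, which does
not happen for inputs in `PC_b(ℝ₊, U)` if the system is forward complete). -/
noncomputable def mildFlow (T : C0Semigroup 𝕜 X) (f : X → U → X) (t : ℝ) (x : X) (u : ℝ → U) : X :=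
  if h : ∃ z, IsMildSolution T f u z ∧ z 0 = x then h.choose t else 0

/-- The right-hand side `B u + C (x, u)` of a generalized bilinear system. -/
def bilinearRHS (B : U →L[𝕜] X) (C : X → U → X) (x : X) (v : U) : X :=
  B v + C x v

/-- `W x = ln (1 + ∫₀^∞ ‖T t x‖² dt)`. -/
noncomputable def logLyapunov (T : C0Semigroup 𝕜 X) (x : X) : ℝ :=
  Real.log (1 + ∫ t in Ioi (0 : ℝ), ‖T t x‖ ^ 2)

end Systems

/-! The nonlinearity vanishes at zero input and grows linearly in the state for bounded inputs.
Grönwall's inequality therefore bounds solutions in advance on every bounded interval. The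
nonlinearity can be truncated to a globally Lipschitz one without changing them, and a contraction
argument plus gluing gives `isForwardComplete`.

With zero input the flow is the semigroup itself. Uniform attraction of the unit ball makes some `‖T
t₀‖` at most 1/2, and powers of `T t₀` then decay exponentially
(`isExponentiallyStable_of_norm_le_half`). Conversely, let `T` be exponentially stable. After
multiplication by `exp (lam * t)`, Grönwall with kernel `M * ξ ‖u‖` yields a bound in which the
initial state is multiplied by an exponential of the input integral; Young's inequality separates
the two and gives iISS. If `ξ ‖u‖` is uniformly small, the bilinear term costs only half of the
decay rate, which gives ISS for small inputs.

The square root of the energy is subadditive and, under exponential stability, bounded by a multiple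
of the norm. Along the flow the energy has dissipation `-‖x‖ ^ 2`, but the bilinear term contributes
something quadratic in the state times a function of the input. The logarithm divides by `1 +
energy` and makes this a pure input gain (`lieDerivative_logLyapunov_le`). In the other direction,
the upper bound on `W` bounds the energy on the unit sphere, and Datko's theorem
(`isExponentiallyStable_of_energy_le`) applies. -/

namespace C0Semigroup

variable {𝕜 X : Type*} [RCLike 𝕜] [NormedAddCommGroup X] [NormedSpace 𝕜 X]
  (T : C0Semigroup 𝕜 X)

/-! ### Semigroups: local bounds, joint continuity, exponential decay -/

lemma zero_apply (x : X) : T 0 x = x := by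
  rw [T.map_zero]; rfl

lemma add_apply {s t : ℝ} (hs : 0 ≤ s) (ht : 0 ≤ t) (x : X) : T (s + t) x = T s (T t x) := by
  rw [T.map_add s t hs ht]; rfl

lemma tendsto_zero (x : X) : Tendsto (fun t => T t x) (𝓝[≥] 0) (𝓝 x) := by
  have h : ContinuousWithinAt (fun t => T t x) (Ioi 0) 0 := by
    simpa [ContinuousWithinAt, T.zero_apply] using T.strong_continuity x
  have := continuousWithinAt_Ioi_iff_Ici.1 h
  simpa [ContinuousWithinAt, T.zero_apply] using this

lemma norm_map_add_le {s t : ℝ} (hs : 0 ≤ s) (ht : 0 ≤ t) : ‖T (s + t)‖ ≤ ‖T s‖ * ‖T t‖ := by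
  rw [T.map_add s t hs ht]; exact ContinuousLinearMap.opNorm_comp_le _ _

/-- Otherwise the norms blow up along some `t n → 0`, while every orbit `T (t n) x` converges; this
contradicts Banach–Steinhaus. -/
lemma exists_bound_near_zero [CompleteSpace X] :
    ∃ δ M : ℝ, 0 < δ ∧ 1 ≤ M ∧ ∀ t ∈ Icc 0 δ, ‖T t‖ ≤ M := by
  by_contra! hcon
  have h1 (n : ℕ) : ∃ t ∈ Icc (0 : ℝ) (1 / (n + 1)), (n + 1 : ℝ) < ‖T t‖ :=
    hcon (1 / (n + 1)) (n + 1) (by positivity) (by simp)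
  choose t ht htn using h1
  have htlim : Tendsto t atTop (𝓝[≥] 0) := by
    refine tendsto_nhdsWithin_iff.2 ⟨?_, Eventually.of_forall fun n => (ht n).1⟩
    exact squeeze_zero (fun n => (ht n).1) (fun n => (ht n).2)
      tendsto_one_div_add_atTop_nhds_zero_nat
  obtain ⟨C, hC⟩ := banach_steinhaus (g := fun n => T (t n)) (fun x => by
    obtain ⟨C, hC⟩ := ((T.tendsto_zero x).comp htlim).norm.bddAbove_range
    exact ⟨C, fun n => hC ⟨n, rfl⟩⟩)
  obtain ⟨n, hn⟩ := exists_nat_gt C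
  linarith [hC n, htn n]

lemma exists_bound [CompleteSpace X] (τ : ℝ) : ∃ M : ℝ, 1 ≤ M ∧ ∀ t ∈ Icc 0 τ, ‖T t‖ ≤ M := by
  obtain ⟨δ, M, hδ, hM, hb⟩ := T.exists_bound_near_zero
  have key (n : ℕ) : ∀ t ∈ Icc 0 (n * δ), ‖T t‖ ≤ M ^ (n + 1) := by
    induction n with
    | zero =>
      intro t ht
      have : t ∈ Icc 0 δ := ⟨ht.1, ht.2.trans (by simpa using hδ.le)⟩
      simpa using hb t this
    | succ n ih =>
      intro t ht
      by_cases h : t ≤ δ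
      · exact (hb t ⟨ht.1, h⟩).trans (le_self_pow₀ hM (by simp))
      · push Not at h
        have h2 : ‖T (t - δ)‖ ≤ M ^ (n + 1) := ih _ ⟨by linarith, by
          have := ht.2; push_cast at this; linarith⟩
        have h3 := T.norm_map_add_le (s := t - δ) (t := δ) (by linarith) hδ.le
        rw [sub_add_cancel] at h3
        rw [pow_succ]
        exact h3.trans (mul_le_mul h2 (hb δ ⟨hδ.le, le_rfl⟩) (norm_nonneg _) (by positivity))
  obtain ⟨n, hn⟩ := exists_nat_gt (τ / δ)
  refine ⟨M ^ (n + 1), one_le_pow₀ hM, fun t ht => key n t ⟨ht.1, ht.2.trans ?_⟩⟩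
  exact ((div_lt_iff₀ hδ).1 hn).le

lemma norm_sub_apply_le {M a b τ : ℝ} (hM : ∀ t ∈ Icc 0 τ, ‖T t‖ ≤ M)
    (ha : a ∈ Icc 0 τ) (hb : b ∈ Icc 0 τ) (x : X) :
    ‖T a x - T b x‖ ≤ M * ‖T |a - b| x - x‖ := by
  wlog hab : b ≤ a generalizing a b
  · rw [norm_sub_rev, abs_sub_comm]
    exact this hb ha (le_of_not_ge hab)
  rw [abs_of_nonneg (sub_nonneg.2 hab)]
  have : T a x = T b (T (a - b) x) := by
    rw [← T.add_apply hb.1 (sub_nonneg.2 hab), add_sub_cancel]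
  rw [this, ← map_sub]
  exact (T b).le_of_opNorm_le (hM b hb) _

/-- The semigroup, extended by the identity to negative times, is jointly continuous. -/
lemma continuous_max [CompleteSpace X] : Continuous (fun p : ℝ × X => T (max p.1 0) p.2) := by
  refine continuous_iff_continuousAt.2 fun ⟨b, x⟩ => ?_
  obtain ⟨M, hM1, hM⟩ := T.exists_bound (max (b + 1) 0)
  refine tendsto_iff_norm_sub_tendsto_zero.2 ?_
  have hlim : Tendsto (fun p : ℝ × X => M * ‖p.2 - x‖ + M * ‖T |max p.1 0 - max b 0| x - x‖)
      (𝓝 (b, x)) (𝓝 (M * 0 + M * 0)) := by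
    refine (Tendsto.const_mul _ ?_).add (Tendsto.const_mul _ ?_)
    · have : Continuous fun p : ℝ × X => ‖p.2 - x‖ := by fun_prop
      simpa using this.tendsto (b, x)
    · refine tendsto_iff_norm_sub_tendsto_zero.1 ((T.tendsto_zero x).comp ?_)
      refine tendsto_nhdsWithin_iff.2 ⟨?_, Eventually.of_forall fun p => mem_Ici.2 (abs_nonneg _)⟩
      have : Continuous fun p : ℝ × X => |max p.1 0 - max b 0| := by fun_prop
      simpa using this.tendsto (b, x)
  simp only [mul_zero, add_zero] at hlim
  refine squeeze_zero' (Eventually.of_forall fun p => norm_nonneg _) ?_ hlim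
  have hev : ∀ᶠ p : ℝ × X in 𝓝 (b, x), p.1 < b + 1 :=
    (continuous_fst.tendsto (b, x)).eventually (gt_mem_nhds (by simp))
  filter_upwards [hev] with p hp
  have ha : max p.1 0 ∈ Icc 0 (max (b + 1) 0) := ⟨le_max_right _ _, max_le_max_right _ hp.le⟩
  have hb : max b 0 ∈ Icc 0 (max (b + 1) 0) :=
    ⟨le_max_right _ _, max_le_max_right _ (by linarith)⟩
  calc ‖T (max p.1 0) p.2 - T (max b 0) x‖
      = ‖T (max p.1 0) (p.2 - x) + (T (max p.1 0) x - T (max b 0) x)‖ := by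
        rw [map_sub]; congr 1; abel
    _ ≤ ‖T (max p.1 0) (p.2 - x)‖ + ‖T (max p.1 0) x - T (max b 0) x‖ := norm_add_le _ _
    _ ≤ _ := add_le_add ((T _).le_of_opNorm_le (hM _ ha) _) (T.norm_sub_apply_le hM ha hb x)

lemma continuousOn_apply [CompleteSpace X] (x : X) : ContinuousOn (fun t => T t x) (Ici 0) := by
  have h : Continuous fun t : ℝ => T (max t 0) x :=
    T.continuous_max.comp (continuous_id.prodMk continuous_const)
  refine h.continuousOn.congr fun t ht => ?_
  simp [max_eq_left (show (0 : ℝ) ≤ t from ht)]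

lemma norm_nat_mul_le {t₀ : ℝ} (ht₀ : 0 ≤ t₀) (h : ‖T t₀‖ ≤ 1 / 2) (n : ℕ) :
    ‖T (n * t₀)‖ ≤ (1 / 2) ^ n := by
  induction n with
  | zero => simpa [T.map_zero] using ContinuousLinearMap.norm_id_le (𝕜 := 𝕜) (E := X)
  | succ n ih =>
    have := T.norm_map_add_le (s := n * t₀) (t := t₀) (by positivity) ht₀
    push_cast
    rw [add_mul, one_mul, pow_succ]
    exact this.trans (mul_le_mul ih h (norm_nonneg _) (by positivity))

/-- Split `t` into `n * t₀` plus a remainder in `[0, t₀]`. The factor 2 in the constant pays for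
rounding `t / t₀` down to `n`. -/
lemma isExponentiallyStable_of_norm_le_half [CompleteSpace X] {t₀ : ℝ} (ht₀ : 0 < t₀)
    (h : ‖T t₀‖ ≤ 1 / 2) : T.IsExponentiallyStable := by
  obtain ⟨M, hM1, hM⟩ := T.exists_bound t₀
  refine ⟨2 * M, Real.log 2 / t₀, by positivity, by positivity, fun t ht => ?_⟩
  set n := ⌊t / t₀⌋₊
  have hn1 : (n : ℝ) ≤ t / t₀ := Nat.floor_le (by positivity)
  have hn2 : t / t₀ < n + 1 := Nat.lt_floor_add_one _
  have hn1' : n * t₀ ≤ t := (le_div_iff₀ ht₀).1 hn1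
  have hn2' : t < (n + 1) * t₀ := (div_lt_iff₀ ht₀).1 hn2
  have h1 := T.norm_map_add_le (s := t - n * t₀) (t := n * t₀) (by linarith) (by positivity)
  rw [sub_add_cancel] at h1
  have h2 : ((1 : ℝ) / 2) ^ n ≤ 2 * Real.exp (-(Real.log 2 / t₀) * t) := by
    have e1 : ((1 : ℝ) / 2) ^ n = Real.exp (-(n * Real.log 2)) := by
      rw [Real.exp_neg, Real.exp_nat_mul, Real.exp_log two_pos, one_div, inv_pow]
    have e2 : 2 * Real.exp (-(Real.log 2 / t₀) * t) =
        Real.exp (Real.log 2 + -(Real.log 2 / t₀) * t) := by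
      rw [Real.exp_add, Real.exp_log two_pos]
    rw [e1, e2, Real.exp_le_exp]
    have : Real.log 2 / t₀ * t = Real.log 2 * (t / t₀) := by ring
    have l2 : 0 < Real.log 2 := Real.log_pos one_lt_two
    nlinarith
  calc ‖T t‖ ≤ ‖T (t - n * t₀)‖ * ‖T (n * t₀)‖ := h1
    _ ≤ M * (2 * Real.exp (-(Real.log 2 / t₀) * t)) :=
      mul_le_mul (hM _ ⟨by linarith, by linarith⟩) ((T.norm_nat_mul_le ht₀.le h n).trans h2)
        (norm_nonneg _) (by linarith)
    _ = _ := by ring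

end C0Semigroup

/-- Grönwall's inequality in integral form, for a right-continuous kernel. -/
lemma le_mul_exp_integral_of_le_add_integral {a τ : ℝ} {k y : ℝ → ℝ}
    (hy : ContinuousOn y (Icc 0 τ)) (hk : IntegrableOn k (Icc 0 τ))
    (hkr : ∀ s ∈ Ico 0 τ, ContinuousWithinAt k (Ici s) s) (hk0 : ∀ s ∈ Icc 0 τ, 0 ≤ k s)
    (h : ∀ t ∈ Icc 0 τ, y t ≤ a + ∫ s in (0 : ℝ)..t, k s * y s) :
    ∀ t ∈ Icc 0 τ, y t ≤ a * Real.exp (∫ s in (0 : ℝ)..t, k s) := by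
  have hky : IntegrableOn (fun s => k s * y s) (Icc 0 τ) := hk.mul_continuousOn hy isCompact_Icc
  have hder {f : ℝ → ℝ} (hf : IntegrableOn f (Icc 0 τ)) {s : ℝ} (hs : s ∈ Ico 0 τ)
      (hc : ContinuousWithinAt f (Ici s) s) :
      HasDerivWithinAt (fun t => ∫ r in (0 : ℝ)..t, f r) (f s) (Ici s) s := by
    refine intervalIntegral.integral_hasDerivWithinAt_right (t := Ioi s) ?_ ?_
      (hc.mono Ioi_subset_Ici_self)
    · rw [intervalIntegrable_iff_integrableOn_Icc_of_le hs.1]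
      exact hf.mono_set (Icc_subset_Icc_right hs.2.le)
    · refine ⟨Ioc s τ, Ioc_mem_nhdsGT hs.2, ?_⟩
      exact (hf.mono_set fun r hr => ⟨hs.1.trans hr.1.le, hr.2⟩).aestronglyMeasurable
  have hcont {f : ℝ → ℝ} (hf : IntegrableOn f (Icc 0 τ)) :
      ContinuousOn (fun t => ∫ r in (0 : ℝ)..t, f r) (Icc 0 τ) := by
    rcases le_or_gt 0 τ with hτ | hτ
    · have := intervalIntegral.continuousOn_primitive_interval (μ := volume) (f := f) (a := 0)
        (b := τ) (by rwa [uIcc_of_le hτ])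
      rwa [uIcc_of_le hτ] at this
    · simp [Icc_eq_empty hτ.not_ge]
  -- The majorant of `y` times the integrating factor has nonpositive right derivative, hence stays
  -- below its initial value `a`. No sign of `a` or `y` is needed.
  have key := image_le_of_deriv_right_le_deriv_boundary (a := 0) (b := τ)
    (f := fun t => (a + ∫ s in (0 : ℝ)..t, k s * y s) * Real.exp (-∫ s in (0 : ℝ)..t, k s))
    (f' := fun t => (k t * y t) * Real.exp (-∫ s in (0 : ℝ)..t, k s) +
      (a + ∫ s in (0 : ℝ)..t, k s * y s) * (Real.exp (-∫ s in (0 : ℝ)..t, k s) * (-k t)))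
    (B := fun _ => a) (B' := fun _ => 0)
    ((continuousOn_const.add (hcont hky)).mul (hcont hk).neg.rexp)
    (fun s hs => by
      have hys : ContinuousWithinAt y (Ici s) s :=
        (hy s ⟨hs.1, hs.2.le⟩).mono_of_mem_nhdsWithin
          (mem_of_superset (Icc_mem_nhdsGE hs.2) (Icc_subset_Icc_left hs.1))
      exact ((hder hky hs ((hkr s hs).mul hys)).const_add a).mul
        ((hder hk hs (hkr s hs)).neg.exp))
    (by simp) continuousOn_const (fun s _ => (hasDerivAt_const s a).hasDerivWithinAt)
    (fun s hs => by
      have h1 := h s ⟨hs.1, hs.2.le⟩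
      have h2 := hk0 s ⟨hs.1, hs.2.le⟩
      have h3 := mul_nonneg (mul_nonneg h2 (sub_nonneg.2 h1))
        (Real.exp_pos (-∫ s in (0 : ℝ)..s, k s)).le
      nlinarith)
  intro t ht
  have h1 := key ht
  simp only [Real.exp_neg, ← div_eq_mul_inv] at h1
  exact (h t ht).trans ((div_le_iff₀ (Real.exp_pos _)).1 h1)

lemma le_mul_exp_of_le_add_mul_integral {a k τ : ℝ} {y : ℝ → ℝ} (hk : 0 ≤ k)
    (hy : ContinuousOn y (Icc 0 τ))
    (h : ∀ t ∈ Icc 0 τ, y t ≤ a + k * ∫ s in (0 : ℝ)..t, y s) :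
    ∀ t ∈ Icc 0 τ, y t ≤ a * Real.exp (k * t) := by
  have := le_mul_exp_integral_of_le_add_integral (a := a) (k := fun _ => k) hy
    (continuousOn_const.integrableOn_Icc) (fun _ _ => continuousWithinAt_const) (fun _ _ => hk)
    (by simpa [intervalIntegral.integral_const_mul] using h)
  simpa [mul_comm k] using this

/-! ### Inputs: measurability and the supremum norm -/

namespace IsPCb

variable {U : Type*} [NormedAddCommGroup U] {u : ℝ → U}

lemma aestronglyMeasurable (hu : IsPCb u) (τ : ℝ) :
    AEStronglyMeasurable u (volume.restrict (Ioc 0 τ)) := by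
  set D := {s | 0 < s ∧ s ≤ τ ∧ ¬ ContinuousAt u s}
  have hD : D.Finite := hu.finite_discontinuities τ
  have h1 : AEStronglyMeasurable u (volume.restrict (Ioc 0 τ \ D)) := by
    refine ContinuousOn.aestronglyMeasurable (fun s hs => ?_)
      (measurableSet_Ioc.diff hD.measurableSet)
    have : ContinuousAt u s := by
      by_contra hcon
      exact hs.2 ⟨hs.1.1, hs.1.2, hcon⟩
    exact this.continuousWithinAt
  rwa [Measure.restrict_congr_set (sdiff_null_ae_eq_self (hD.measure_zero volume))] at h1

lemma bddAbove (hu : IsPCb u) : BddAbove (range fun s : Ici (0 : ℝ) => ‖u s‖) := by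
  obtain ⟨K, hK⟩ := hu.bounded
  exact ⟨K, by rintro _ ⟨s, rfl⟩; exact hK s s.2⟩

lemma norm_le_pcbNorm (hu : IsPCb u) {s : ℝ} (hs : 0 ≤ s) : ‖u s‖ ≤ pcbNorm u :=
  le_ciSup hu.bddAbove (⟨s, hs⟩ : Ici (0 : ℝ))

lemma pcbNorm_nonneg (hu : IsPCb u) : 0 ≤ pcbNorm u :=
  (norm_nonneg _).trans (hu.norm_le_pcbNorm le_rfl)

lemma zero : IsPCb (0 : ℝ → U) where
  right_continuous _ _ := continuousWithinAt_const
  left_limit _ _ := ⟨0, tendsto_const_nhds⟩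
  finite_discontinuities τ := by
    convert finite_empty
    ext s
    simp only [mem_ofPred_eq, mem_empty_iff_false, iff_false, not_and, not_not]
    exact fun _ _ => continuousAt_const
  bounded := ⟨0, by simp⟩

end IsPCb

/-! ### The convolution in the variation-of-constants formula -/

namespace C0Semigroup

variable {𝕜 X : Type*} [RCLike 𝕜] [NormedAddCommGroup X] [NormedSpace 𝕜 X] [CompleteSpace X] (T : C0Semigroup 𝕜 X)

lemma aestronglyMeasurable_conv {g : ℝ → X} {τ : ℝ} (t : ℝ)
    (hg : AEStronglyMeasurable g (volume.restrict (Ioc 0 τ))) :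
    AEStronglyMeasurable (fun s => T (max (t - s) 0) (g s)) (volume.restrict (Ioc 0 τ)) :=
  T.continuous_max.comp_aestronglyMeasurable
    ((continuous_const.sub continuous_id).aestronglyMeasurable.prodMk hg)

lemma intervalIntegrable_conv {g : ℝ → X} {t K : ℝ} (ht : 0 ≤ t)
    (hg : AEStronglyMeasurable g (volume.restrict (Ioc 0 t)))
    (hK : ∀ s ∈ Ioc 0 t, ‖g s‖ ≤ K) :
    IntervalIntegrable (fun s => T (t - s) (g s)) volume 0 t := by
  obtain ⟨M, hM1, hM⟩ := T.exists_bound t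
  rw [intervalIntegrable_iff_integrableOn_Ioc_of_le ht]
  refine Integrable.of_bound ?_ (M * K) ?_
  · refine (T.aestronglyMeasurable_conv t hg).congr ?_
    refine (ae_restrict_iff' measurableSet_Ioc).2 (Eventually.of_forall fun s hs => ?_)
    simp only [max_eq_left (sub_nonneg.2 hs.2)]
  · refine (ae_restrict_iff' measurableSet_Ioc).2 (Eventually.of_forall fun s hs => ?_)
    exact (T _).le_of_opNorm_le_of_le (hM _ ⟨by linarith [hs.2], by linarith [hs.1]⟩) (hK s hs)

variable [NormedSpace ℝ X]

/-- An indicator moves the variable endpoint into the integrand over the fixed interval `(0, τ]`.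
Dominated convergence then applies, since the integrand is continuous in the parameter except at the
single point `s = t`. -/
lemma continuousOn_conv {g : ℝ → X} {τ K : ℝ}
    (hg : AEStronglyMeasurable g (volume.restrict (Ioc 0 τ)))
    (hK : ∀ s ∈ Ioc 0 τ, ‖g s‖ ≤ K) :
    ContinuousOn (fun t => ∫ s in (0 : ℝ)..t, T (t - s) (g s)) (Icc 0 τ) := by
  obtain ⟨M, hM1, hM⟩ := T.exists_bound τ
  have hcongr : ∀ t ∈ Icc 0 τ, ∫ s in (0 : ℝ)..t, T (t - s) (g s) =
      ∫ s in Ioc 0 τ, (Iic t).indicator (fun s => T (max (t - s) 0) (g s)) s := by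
    intro t ht
    have hset : Ioc 0 τ ∩ Iic t = Ioc 0 t := by
      rw [Ioc_inter_Iic, min_eq_right ht.2]
    rw [setIntegral_indicator measurableSet_Iic, hset, intervalIntegral.integral_of_le ht.1]
    refine setIntegral_congr_fun measurableSet_Ioc fun s hs => ?_
    simp only [max_eq_left (sub_nonneg.2 hs.2)]
  refine ContinuousOn.congr (fun t ht => ?_) hcongr
  refine continuousWithinAt_of_dominated (bound := fun _ => M * K)
    (Eventually.of_forall fun t' =>
      (T.aestronglyMeasurable_conv t' hg).indicator measurableSet_Iic) ?_ (integrable_const _) ?_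
  · filter_upwards [self_mem_nhdsWithin] with t' ht'
    refine (ae_restrict_iff' measurableSet_Ioc).2 (Eventually.of_forall fun s hs => ?_)
    have hle : ‖T (max (t' - s) 0) (g s)‖ ≤ M * K :=
      (T _).le_of_opNorm_le_of_le (hM _ ⟨le_max_right _ _,
        max_le (by linarith [hs.1, ht'.2]) (by linarith [ht'.1, ht'.2])⟩) (hK s hs)
    exact (norm_indicator_le_norm_self _ _).trans hle
  · have hne : ∀ᵐ s ∂(volume.restrict (Ioc 0 τ)), s ≠ t :=
      ae_restrict_of_ae (Measure.ae_ne volume t)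
    filter_upwards [hne] with s hs
    have hc : ContinuousAt (fun t' => T (max (t' - s) 0) (g s)) t :=
      (T.continuous_max.comp ((continuous_id.sub continuous_const).prodMk
        continuous_const)).continuousAt
    refine ContinuousAt.continuousWithinAt ?_
    rcases lt_or_gt_of_ne hs with h | h
    · refine hc.congr ?_
      filter_upwards [lt_mem_nhds h] with t' ht'
      simp [indicator, ht'.le]
    · refine (continuousAt_const (y := (0 : X))).congr ?_
      filter_upwards [gt_mem_nhds h] with t' ht'
      simp [indicator, ht'.not_ge]

end C0Semigroup

lemma integral_exp_const_mul {k : ℝ} (hk : k ≠ 0) (t : ℝ) :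
    ∫ s in (0 : ℝ)..t, Real.exp (k * s) = (Real.exp (k * t) - 1) / k := by
  rw [intervalIntegral.integral_comp_mul_left Real.exp hk, integral_exp, smul_eq_mul, mul_zero,
    Real.exp_zero, div_eq_inv_mul]

/-- The radial retraction onto the ball of radius `R`. -/
noncomputable def radialRetraction {X : Type*} [NormedAddCommGroup X] [NormedSpace ℝ X]
    (R : ℝ) (x : X) : X :=
  (R / max R ‖x‖) • x

/-! ### Radial retraction -/

section Retraction

variable {X : Type*} [NormedAddCommGroup X] [NormedSpace ℝ X] {R : ℝ}

lemma radialRetraction_of_norm_le (hR : 0 < R) {x : X} (hx : ‖x‖ ≤ R) :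
    radialRetraction R x = x := by
  rw [radialRetraction, max_eq_left hx, div_self hR.ne', one_smul]

lemma norm_radialRetraction (hR : 0 < R) (x : X) :
    ‖radialRetraction R x‖ = R * ‖x‖ / max R ‖x‖ := by
  have : 0 < max R ‖x‖ := lt_max_of_lt_left hR
  rw [radialRetraction, norm_smul, Real.norm_of_nonneg (by positivity)]
  ring

lemma norm_radialRetraction_le_radius (hR : 0 < R) (x : X) : ‖radialRetraction R x‖ ≤ R := by
  have : 0 < max R ‖x‖ := lt_max_of_lt_left hR
  rw [norm_radialRetraction hR, div_le_iff₀ this]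
  exact mul_le_mul_of_nonneg_left (le_max_right _ _) hR.le

lemma norm_radialRetraction_le (hR : 0 < R) (x : X) : ‖radialRetraction R x‖ ≤ ‖x‖ := by
  have : 0 < max R ‖x‖ := lt_max_of_lt_left hR
  rw [norm_radialRetraction hR, div_le_iff₀ this, mul_comm]
  exact mul_le_mul_of_nonneg_left (le_max_left _ _) (norm_nonneg _)

/-- The difference is a scaled copy of `x - y` plus the change of the scaling factor applied to `x`;
each part costs at most `‖x - y‖`. -/
lemma norm_radialRetraction_sub_le (hR : 0 < R) (x y : X) :
    ‖radialRetraction R x - radialRetraction R y‖ ≤ 2 * ‖x - y‖ := by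
  set m := max R ‖x‖ with hm
  set n := max R ‖y‖ with hn
  have hm0 : 0 < m := lt_max_of_lt_left hR
  have hn0 : 0 < n := lt_max_of_lt_left hR
  have hmn : |n - m| ≤ ‖x - y‖ := by
    rw [hm, hn, max_comm R, max_comm R]
    refine (abs_max_sub_max_le_abs _ _ _).trans ?_
    rw [norm_sub_rev]
    exact abs_norm_sub_norm_le y x
  have e : radialRetraction R x - radialRetraction R y
      = (R / n) • (x - y) + (R / m * ((n - m) / n)) • x := by
    have : R / m = R / n + R / m * ((n - m) / n) := by field_simp; ring
    rw [radialRetraction, radialRetraction, ← hm, ← hn]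
    conv_lhs => rw [this]
    rw [add_smul, smul_sub]; abel
  rw [e]
  refine (norm_add_le _ _).trans ?_
  have h1 : ‖(R / n) • (x - y)‖ ≤ ‖x - y‖ := by
    rw [norm_smul, Real.norm_of_nonneg (by positivity)]
    exact mul_le_of_le_one_left (norm_nonneg _) ((div_le_one hn0).2 (le_max_left _ _))
  have h2 : ‖(R / m * ((n - m) / n)) • x‖ ≤ ‖x - y‖ := by
    rw [norm_smul, norm_mul, norm_div (n - m), Real.norm_of_nonneg (show 0 ≤ R / m by positivity),
      Real.norm_of_nonneg hn0.le, Real.norm_eq_abs]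
    calc R / m * (|n - m| / n) * ‖x‖ = (R / n) * (‖x‖ / m) * |n - m| := by ring
      _ ≤ 1 * 1 * |n - m| := by
        gcongr
        · exact (div_le_one hn0).2 (le_max_left _ _)
        · exact (div_le_one hm0).2 (le_max_right _ _)
      _ ≤ ‖x - y‖ := by simpa using hmn
  linarith

end Retraction

/-! ### Admissible nonlinearities along trajectories -/

section Admissible

variable {X U : Type*} [NormedAddCommGroup X] [NormedAddCommGroup U] {f : X → U → X}

lemma IsAdmissibleNonlinearity.continuous (hf : IsAdmissibleNonlinearity f) :
    Continuous (Function.uncurry f) := by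
  refine continuous_iff_continuousAt.2 fun ⟨x, v⟩ => ?_
  obtain ⟨L, hL, hlip⟩ := hf.1 (‖x‖ + ‖v‖ + 1) (by positivity)
  refine tendsto_iff_norm_sub_tendsto_zero.2 ?_
  have hlim : Tendsto (fun p : X × U => L * ‖p.1 - x‖ + ‖f x p.2 - f x v‖)
      (𝓝 (x, v)) (𝓝 0) := by
    have hc := hf.2 x
    have : Continuous (fun p : X × U => L * ‖p.1 - x‖ + ‖f x p.2 - f x v‖) := by fun_prop
    simpa using this.tendsto (x, v)
  refine squeeze_zero' (Eventually.of_forall fun p => norm_nonneg _) ?_ hlim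
  have h1 : ∀ᶠ p : X × U in 𝓝 (x, v), ‖p.1‖ < ‖x‖ + ‖v‖ + 1 :=
    (continuous_fst.norm.tendsto (x, v)).eventually
      (gt_mem_nhds (by dsimp only; linarith [norm_nonneg v]))
  have h2 : ∀ᶠ p : X × U in 𝓝 (x, v), ‖p.2‖ < ‖x‖ + ‖v‖ + 1 :=
    (continuous_snd.norm.tendsto (x, v)).eventually
      (gt_mem_nhds (by dsimp only; linarith [norm_nonneg x]))
  filter_upwards [h1, h2] with p hp1 hp2
  calc ‖f p.1 p.2 - f x v‖ = ‖(f p.1 p.2 - f x p.2) + (f x p.2 - f x v)‖ := by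
        congr 1; abel
    _ ≤ ‖f p.1 p.2 - f x p.2‖ + ‖f x p.2 - f x v‖ := norm_add_le _ _
    _ ≤ _ := add_le_add_left (hlip _ _ _ (by linarith [norm_nonneg v]) hp1 hp2) _

/-- `f` grows at most linearly in the state, uniformly for bounded input values. -/
def HasLinearGrowth (f : X → U → X) : Prop :=
  ∀ K : ℝ, ∃ c : ℝ, 0 ≤ c ∧ ∀ x v, ‖v‖ ≤ K → ‖f x v‖ ≤ c * (1 + ‖x‖)

lemma IsAdmissibleNonlinearity.aestronglyMeasurable (hf : IsAdmissibleNonlinearity f)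
    {u : ℝ → U} (hu : IsPCb u) {z : ℝ → X} {τ : ℝ} (hz : ContinuousOn z (Icc 0 τ)) :
    AEStronglyMeasurable (fun s => f (z s) (u s)) (volume.restrict (Ioc 0 τ)) :=
  hf.continuous.comp_aestronglyMeasurable
    (((hz.mono Ioc_subset_Icc_self).aestronglyMeasurable measurableSet_Ioc).prodMk
      (hu.aestronglyMeasurable τ))

lemma IsAdmissibleNonlinearity.continuousWithinAt (hf : IsAdmissibleNonlinearity f)
    {u : ℝ → U} (hu : IsPCb u) {z : ℝ → X} {s : ℝ} (hs : 0 ≤ s) (hz : ContinuousOn z (Ici 0)) :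
    ContinuousWithinAt (fun s => f (z s) (u s)) (Ici s) s :=
  hf.continuous.continuousAt.comp_continuousWithinAt
    (((hz s hs).mono (Ici_subset_Ici.2 hs)).prodMk (hu.right_continuous s hs))

lemma HasLinearGrowth.exists_bound (hg : HasLinearGrowth f) {u : ℝ → U} (hu : IsPCb u)
    {z : ℝ → X} {τ : ℝ} (hz : ContinuousOn z (Icc 0 τ)) :
    ∃ K, ∀ s ∈ Icc 0 τ, ‖f (z s) (u s)‖ ≤ K := by
  obtain ⟨c, hc, hfc⟩ := hg (pcbNorm u)
  obtain ⟨R, hR⟩ := isCompact_Icc.exists_bound_of_continuousOn hz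
  refine ⟨c * (1 + R), fun s hs => (hfc _ _ (hu.norm_le_pcbNorm hs.1)).trans ?_⟩
  gcongr
  exact hR s hs

end Admissible

/-! ### Mild solutions: existence and uniqueness -/

namespace C0Semigroup

variable {𝕜 X : Type*} [RCLike 𝕜] [NormedAddCommGroup X] [NormedSpace 𝕜 X] [NormedSpace ℝ X]
  (T : C0Semigroup 𝕜 X)

lemma norm_conv_le {g : ℝ → X} {b : ℝ → ℝ} {M t : ℝ} (ht : 0 ≤ t)
    (hM : ∀ s ∈ Icc 0 t, ‖T s‖ ≤ M) (hg : ∀ s ∈ Ioc 0 t, ‖g s‖ ≤ b s)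
    (hb : IntervalIntegrable b volume 0 t) :
    ‖∫ s in (0 : ℝ)..t, T (t - s) (g s)‖ ≤ M * ∫ s in (0 : ℝ)..t, b s := by
  rw [← intervalIntegral.integral_const_mul]
  refine intervalIntegral.norm_integral_le_of_norm_le ht
    (Eventually.of_forall fun s hs => ?_) (hb.const_mul M)
  exact (T _).le_of_opNorm_le_of_le (hM _ ⟨by linarith [hs.2], by linarith [hs.1]⟩) (hg s hs)

/-- A priori bound by Grönwall for `1 + ‖z‖`. Only the growth of the forcing `g` along `z` enters,
so the bound holds equally for the truncated equation. -/
lemma norm_le_of_linear_growth {g z : ℝ → X} {x : X} {M c τ : ℝ} (hc : 0 ≤ c)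
    (hM : ∀ t ∈ Icc 0 τ, ‖T t‖ ≤ M) (hM0 : 0 ≤ M) (hz : ContinuousOn z (Icc 0 τ))
    (hsol : ∀ t ∈ Icc 0 τ, z t = T t x + ∫ s in (0 : ℝ)..t, T (t - s) (g s))
    (hg : ∀ s ∈ Icc 0 τ, ‖g s‖ ≤ c * (1 + ‖z s‖)) :
    ∀ t ∈ Icc 0 τ, ‖z t‖ ≤ (1 + M * ‖x‖) * Real.exp (M * c * τ) := by
  have hy : ContinuousOn (fun t => 1 + ‖z t‖) (Icc 0 τ) := continuousOn_const.add hz.norm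
  have key := le_mul_exp_of_le_add_mul_integral (a := 1 + M * ‖x‖) (k := M * c)
    (by positivity) hy (fun t ht => by
      have hsub : Icc 0 t ⊆ Icc 0 τ := Icc_subset_Icc_right ht.2
      have h1 := T.norm_conv_le (g := g) (b := fun s => c * (1 + ‖z s‖)) ht.1
        (fun s hs => hM s (hsub hs))
        (fun s hs => hg s (hsub (Ioc_subset_Icc_self hs)))
        ((hy.mono hsub).intervalIntegrable_of_Icc ht.1 |>.const_mul c)
      rw [intervalIntegral.integral_const_mul, ← mul_assoc] at h1
      have h2 : ‖z t‖ ≤ ‖T t x‖ + ‖∫ s in (0 : ℝ)..t, T (t - s) (g s)‖ := by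
        conv_lhs => rw [hsol t ht]
        exact norm_add_le _ _
      have h3 : ‖T t x‖ ≤ M * ‖x‖ := (T t).le_of_opNorm_le (hM t ht) x
      linarith)
  intro t ht
  have h1 := key t ht
  have h2 : Real.exp (M * c * t) ≤ Real.exp (M * c * τ) :=
    Real.exp_le_exp.2 (mul_le_mul_of_nonneg_left ht.2 (by positivity))
  have h3 : (1 + M * ‖x‖) * Real.exp (M * c * t) ≤ (1 + M * ‖x‖) * Real.exp (M * c * τ) := by
    gcongr
  linarith

variable [CompleteSpace X]

/-- Existence of mild solutions for globally Lipschitz nonlinearities. -/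
lemma exists_solution_of_lipschitz {F : ℝ → X → X} {τ L K : ℝ} (hτ : 0 ≤ τ) (hL : 0 ≤ L)
    (hmeas : ∀ z : ℝ → X, Continuous z →
      AEStronglyMeasurable (fun s => F s (z s)) (volume.restrict (Ioc 0 τ)))
    (hlip : ∀ s ∈ Ioc 0 τ, ∀ x y, ‖F s x - F s y‖ ≤ L * ‖x - y‖)
    (hK : ∀ s ∈ Ioc 0 τ, ‖F s 0‖ ≤ K) (x : X) :
    ∃ z : ℝ → X, Continuous z ∧
      ∀ t ∈ Icc 0 τ, z t = T t x + ∫ s in (0 : ℝ)..t, T (t - s) (F s (z s)) := by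
  obtain ⟨M, hM1, hM⟩ := T.exists_bound τ
  -- With weight `exp (-(k * t))` the fixed-point map has Lipschitz constant `M * L / k ≤ 1 / 2`, so
  -- one contraction covers all of `[0, τ]`.
  set k := 2 * M * L + 1
  have hk : 0 < k := by positivity
  -- The unknown `y` is the weighted solution; `ext` removes the weight and extends to the whole
  -- line.
  let ext : C(Icc 0 τ, X) → ℝ → X := fun y s => Real.exp (k * s) • y (projIcc 0 τ hτ s)
  have hext (y) : Continuous (ext y) := by
    have := y.continuous.comp (continuous_projIcc (h := hτ))
    exact (Real.continuous_exp.comp (continuous_const.mul continuous_id)).smul this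
  have hbdd (y) : ∃ K', ∀ s ∈ Ioc 0 τ, ‖F s (ext y s)‖ ≤ K' := by
    obtain ⟨R, hR⟩ := isCompact_Icc.exists_bound_of_continuousOn
      (hext y).continuousOn (s := Icc 0 τ)
    refine ⟨L * R + K, fun s hs => ?_⟩
    have h1 := hlip s hs (ext y s) 0
    have h2 : L * ‖ext y s‖ ≤ L * R :=
      mul_le_mul_of_nonneg_left (hR s (Ioc_subset_Icc_self hs)) hL
    rw [sub_zero] at h1
    have h3 := norm_le_norm_add_norm_sub' (F s (ext y s)) (F s 0)
    linarith [hK s hs]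
  have hint (y) {t : ℝ} (ht : t ∈ Icc 0 τ) :
      IntervalIntegrable (fun s => T (t - s) (F s (ext y s))) volume 0 t := by
    obtain ⟨K', hK'⟩ := hbdd y
    have hsub : Ioc 0 t ⊆ Ioc 0 τ := Ioc_subset_Ioc_right ht.2
    exact T.intervalIntegrable_conv ht.1 ((hmeas _ (hext y)).mono_measure
      (Measure.restrict_mono_set _ hsub)) fun s hs => hK' s (hsub hs)
  have hcont (y) : ContinuousOn (fun t => Real.exp (-(k * t)) •
      (T t x + ∫ s in (0 : ℝ)..t, T (t - s) (F s (ext y s)))) (Icc 0 τ) := by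
    obtain ⟨K', hK'⟩ := hbdd y
    refine ContinuousOn.smul (Continuous.continuousOn (by fun_prop)) ?_
    exact ((T.continuousOn_apply x).mono Icc_subset_Ici_self).add
      (T.continuousOn_conv (hmeas _ (hext y)) hK')
  let Φ : C(Icc 0 τ, X) → C(Icc 0 τ, X) := fun y =>
    ⟨fun t => Real.exp (-(k * t)) • (T t x + ∫ s in (0 : ℝ)..t, T (t - s) (F s (ext y s))),
      continuousOn_iff_continuous_domRestrict.1 (hcont y)⟩
  have hΦ_apply (y) (t : Icc 0 τ) : Φ y t = Real.exp (-(k * t)) •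
      (T t x + ∫ s in (0 : ℝ)..t, T (t - s) (F s (ext y s))) := rfl
  have hΦ : ContractingWith (1 / 2) Φ := by
    refine ⟨by norm_num, LipschitzWith.of_dist_le_mul fun y y' => ?_⟩
    refine (ContinuousMap.dist_le (by positivity)).2 fun t => ?_
    have hdiff (s : ℝ) : ‖ext y s - ext y' s‖ ≤ Real.exp (k * s) * dist y y' := by
      rw [← smul_sub, norm_smul, Real.norm_of_nonneg (Real.exp_pos _).le, ← dist_eq_norm]
      exact mul_le_mul_of_nonneg_left (ContinuousMap.dist_apply_le_dist _) (Real.exp_pos _).le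
    have hsub : Icc 0 (t : ℝ) ⊆ Icc 0 τ := Icc_subset_Icc_right t.2.2
    have h1 := T.norm_conv_le (g := fun s => F s (ext y s) - F s (ext y' s))
      (b := fun s => L * dist y y' * Real.exp (k * s)) t.2.1 (fun s hs => hM s (hsub hs))
      (fun s hs => by
        refine (hlip s ⟨hs.1, hs.2.trans t.2.2⟩ _ _).trans ?_
        calc L * ‖ext y s - ext y' s‖ ≤ L * (Real.exp (k * s) * dist y y') :=
              mul_le_mul_of_nonneg_left (hdiff s) hL
          _ = _ := by ring)
      (Continuous.intervalIntegrable (by fun_prop) _ _)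
    simp only [map_sub] at h1
    rw [intervalIntegral.integral_sub (hint y t.2) (hint y' t.2),
      intervalIntegral.integral_const_mul, integral_exp_const_mul hk.ne'] at h1
    have h2 : dist (Φ y t) (Φ y' t) = Real.exp (-(k * t)) *
        ‖(∫ s in (0 : ℝ)..t, T (t - s) (F s (ext y s))) -
          ∫ s in (0 : ℝ)..t, T (t - s) (F s (ext y' s))‖ := by
      rw [dist_eq_norm, hΦ_apply, hΦ_apply, ← smul_sub, add_sub_add_left_eq_sub, norm_smul,
        Real.norm_of_nonneg (Real.exp_pos _).le]
    have h3 : Real.exp (-(k * t)) * Real.exp (k * t) = 1 := by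
      rw [← Real.exp_add]; simp
    have h4 : M * L / k ≤ 1 / 2 := by rw [div_le_iff₀ hk]; linarith
    rw [h2]
    calc _ ≤ Real.exp (-(k * t)) *
          (M * (L * dist y y' * ((Real.exp (k * t) - 1) / k))) := by gcongr
      _ = (M * L / k) * dist y y' *
          (Real.exp (-(k * t)) * Real.exp (k * t) - Real.exp (-(k * t))) := by ring
      _ ≤ (M * L / k) * dist y y' * 1 := by
          rw [h3]
          gcongr
          linarith [Real.exp_pos (-(k * (t : ℝ)))]
      _ ≤ (1 / 2) * dist y y' * 1 := by
          gcongr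
      _ = ((1 / 2 : NNReal) : ℝ) * dist y y' := by simp
  have hfix := hΦ.fixedPoint_isFixedPt
  set y := ContractingWith.fixedPoint Φ hΦ
  refine ⟨ext y, hext y, fun t ht => ?_⟩
  have h1 : y ⟨t, ht⟩ = Φ y ⟨t, ht⟩ := by rw [hfix]
  change Real.exp (k * t) • y (projIcc 0 τ hτ t) = _
  rw [projIcc_of_mem hτ ht, h1, hΦ_apply, smul_smul, ← Real.exp_add, add_neg_cancel, Real.exp_zero, one_smul]

variable {U : Type*} [NormedAddCommGroup U] {f : X → U → X} {u : ℝ → U}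

/-- Existence of mild solutions on bounded intervals. -/
lemma exists_solution_Icc (hf : IsAdmissibleNonlinearity f) (hg : HasLinearGrowth f)
    (hu : IsPCb u) (x : X) {τ : ℝ} (hτ : 0 ≤ τ) :
    ∃ z : ℝ → X, ContinuousOn z (Icc 0 τ) ∧
      ∀ t ∈ Icc 0 τ, z t = T t x + ∫ s in (0 : ℝ)..t, T (t - s) (f (z s) (u s)) := by
  obtain ⟨M, hM1, hM⟩ := T.exists_bound τ
  obtain ⟨c, hc, hfc⟩ := hg (pcbNorm u)
  -- The a priori bound. The retraction does not increase norms, so the truncated equation obeys it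
  -- too and its solution never leaves the region where the truncation is the identity.
  set R := (1 + M * ‖x‖) * Real.exp (M * c * τ)
  have hR : 0 < R := by positivity
  obtain ⟨L, hL, hlip⟩ := hf.1 (R + pcbNorm u + 1) (by linarith [hu.pcbNorm_nonneg])
  obtain ⟨z, hz, hsol⟩ := T.exists_solution_of_lipschitz
    (F := fun s x => f (radialRetraction R x) (u s)) (L := L * 2) (K := c) hτ (by positivity)
    (fun z hz => hf.aestronglyMeasurable hu (by
      have : LipschitzWith 2 (radialRetraction (X := X) R) :=
        LipschitzWith.of_dist_le_mul fun x y => by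
          simpa [dist_eq_norm] using norm_radialRetraction_sub_le hR x y
      exact (this.continuous.comp hz).continuousOn))
    (fun s hs x y => by
      have hn := hu.norm_le_pcbNorm hs.1.le
      have h0 := hu.pcbNorm_nonneg
      have h1 := norm_radialRetraction_le_radius hR x
      have h2 := norm_radialRetraction_le_radius hR y
      refine (hlip _ _ _ (by linarith) (by linarith) (by linarith)).trans ?_
      rw [mul_assoc]
      exact mul_le_mul_of_nonneg_left (norm_radialRetraction_sub_le hR x y) hL.le)
    (fun s hs => by
      have := hfc (radialRetraction R 0) (u s) (hu.norm_le_pcbNorm hs.1.le)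
      simpa [radialRetraction_of_norm_le hR (x := (0 : X)) (by simpa using hR.le)] using this) x
  have hzR := T.norm_le_of_linear_growth hc hM (by linarith) hz.continuousOn hsol (fun s hs => by
    refine (hfc _ _ (hu.norm_le_pcbNorm hs.1)).trans ?_
    gcongr
    exact norm_radialRetraction_le hR _)
  refine ⟨z, hz.continuousOn, fun t ht => ?_⟩
  rw [hsol t ht]
  congr 1
  refine intervalIntegral.integral_congr fun s hs => ?_
  rw [uIcc_of_le ht.1] at hs
  simp only [radialRetraction_of_norm_le hR (hzR s ⟨hs.1, hs.2.trans ht.2⟩)]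

omit [NormedSpace ℝ X] in
lemma intervalIntegrable_of_continuousOn (hf : IsAdmissibleNonlinearity f)
    (hg : HasLinearGrowth f) (hu : IsPCb u) {z : ℝ → X} {t : ℝ} (ht : 0 ≤ t)
    (hz : ContinuousOn z (Icc 0 t)) :
    IntervalIntegrable (fun s => T (t - s) (f (z s) (u s))) volume 0 t := by
  obtain ⟨K, hK⟩ := hg.exists_bound hu hz
  exact T.intervalIntegrable_conv ht (hf.aestronglyMeasurable hu hz)
    fun s hs => hK s (Ioc_subset_Icc_self hs)

/-- Both solutions are bounded on the compact interval, so a single Lipschitz constant serves them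
and Grönwall with `a = 0` makes the difference vanish. -/
lemma eqOn_Icc_of_solution (hf : IsAdmissibleNonlinearity f) (hg : HasLinearGrowth f)
    (hu : IsPCb u) {x : X} {τ : ℝ} {z z' : ℝ → X}
    (hz : ContinuousOn z (Icc 0 τ)) (hz' : ContinuousOn z' (Icc 0 τ))
    (hsol : ∀ t ∈ Icc 0 τ, z t = T t x + ∫ s in (0 : ℝ)..t, T (t - s) (f (z s) (u s)))
    (hsol' : ∀ t ∈ Icc 0 τ, z' t = T t x + ∫ s in (0 : ℝ)..t, T (t - s) (f (z' s) (u s))) :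
    EqOn z' z (Icc 0 τ) := by
  obtain ⟨M, hM1, hM⟩ := T.exists_bound τ
  obtain ⟨R, hR⟩ := isCompact_Icc.exists_bound_of_continuousOn hz
  obtain ⟨R', hR'⟩ := isCompact_Icc.exists_bound_of_continuousOn hz'
  obtain ⟨L, hL, hlip⟩ := hf.1 (|R| + |R'| + pcbNorm u + 1) (by
    have := hu.pcbNorm_nonneg; positivity)
  have key := le_mul_exp_of_le_add_mul_integral (a := 0) (k := M * L)
    (y := fun t => ‖z' t - z t‖) (by positivity) (hz'.sub hz).norm (fun t ht => by
      have hsub : Icc 0 t ⊆ Icc 0 τ := Icc_subset_Icc_right ht.2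
      have h1 := T.norm_conv_le (g := fun s => f (z' s) (u s) - f (z s) (u s))
        (b := fun s => L * ‖z' s - z s‖) ht.1 (fun s hs => hM s (hsub hs))
        (fun s hs => by
          have hs' := hsub (Ioc_subset_Icc_self hs)
          have a1 := hR s hs'
          have a2 := hR' s hs'
          have a3 := hu.norm_le_pcbNorm hs.1.le
          have a4 := hu.pcbNorm_nonneg
          have a5 := le_abs_self R
          have a6 := le_abs_self R'
          have a7 := abs_nonneg R
          have a8 := abs_nonneg R'
          exact hlip _ _ _ (by linarith) (by linarith) (by linarith))
        (((hz'.sub hz).norm.mono hsub).intervalIntegrable_of_Icc ht.1 |>.const_mul L)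
      simp only [map_sub] at h1
      rw [intervalIntegral.integral_sub
        (T.intervalIntegrable_of_continuousOn hf hg hu ht.1 (hz'.mono hsub))
        (T.intervalIntegrable_of_continuousOn hf hg hu ht.1 (hz.mono hsub)),
        intervalIntegral.integral_const_mul, ← mul_assoc] at h1
      rw [zero_add]
      refine le_trans (le_of_eq ?_) h1
      rw [hsol t ht, hsol' t ht, add_sub_add_left_eq_sub])
  intro t ht
  have := key t ht
  rw [zero_mul] at this
  exact sub_eq_zero.1 (norm_le_zero_iff.1 this)

theorem isForwardComplete (hf : IsAdmissibleNonlinearity f) (hg : HasLinearGrowth f) :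
    IsForwardComplete T f := by
  intro x u hu
  choose Z hZ hsol using fun n : ℕ => T.exists_solution_Icc hf hg hu x (Nat.cast_nonneg n)
  have hcons {m n : ℕ} {t : ℝ} (hm : t ∈ Icc 0 (m : ℝ)) (hn : t ∈ Icc 0 (n : ℝ)) :
      Z m t = Z n t := by
    have h1 : Icc 0 t ⊆ Icc 0 (m : ℝ) := Icc_subset_Icc_right hm.2
    have h2 : Icc 0 t ⊆ Icc 0 (n : ℝ) := Icc_subset_Icc_right hn.2
    exact T.eqOn_Icc_of_solution hf hg hu ((hZ n).mono h2) ((hZ m).mono h1)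
      (fun s hs => hsol n s (h2 hs)) (fun s hs => hsol m s (h1 hs)) ⟨hm.1, le_rfl⟩
  have hmem {t : ℝ} (ht : 0 ≤ t) : t ∈ Icc 0 ((⌊t⌋₊ + 1 : ℕ) : ℝ) :=
    ⟨ht, by push_cast; exact (Nat.lt_floor_add_one t).le⟩
  -- The index strictly exceeds `t`, so near each time `z` agrees with one fixed `Z n`, which gives
  -- continuity.
  let z : ℝ → X := fun t => Z (⌊t⌋₊ + 1) t
  have hzZ (n : ℕ) : EqOn z (Z n) (Icc 0 (n : ℝ)) := fun t ht => hcons (hmem ht.1) ht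
  have hzc : ContinuousOn z (Ici 0) := by
    intro t ht
    have h1 := ((hZ (⌊t⌋₊ + 1)).congr (hzZ _)) t (hmem ht)
    refine h1.mono_of_mem_nhdsWithin ?_
    have h2 : Iio (((⌊t⌋₊ + 1 : ℕ) : ℝ)) ∈ 𝓝 t :=
      Iio_mem_nhds (by push_cast; exact Nat.lt_floor_add_one t)
    filter_upwards [self_mem_nhdsWithin, mem_nhdsWithin_of_mem_nhds h2] with s hs hs'
    exact ⟨hs, le_of_lt hs'⟩
  have hzsol : ∀ t, 0 ≤ t → z t = T t x + ∫ s in (0 : ℝ)..t, T (t - s) (f (z s) (u s)) := by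
    intro t ht
    rw [hzZ _ (hmem ht), hsol _ t (hmem ht)]
    congr 1
    refine intervalIntegral.integral_congr fun s hs => ?_
    rw [uIcc_of_le ht] at hs
    simp only [hzZ _ (show s ∈ Icc 0 ((⌊t⌋₊ + 1 : ℕ) : ℝ) from ⟨hs.1, hs.2.trans (hmem ht).2⟩)]
  have hz0 : z 0 = x := by rw [hzsol 0 le_rfl]; simp [T.zero_apply]
  refine ⟨z, ⟨⟨hzc, fun t ht => ⟨T.intervalIntegrable_of_continuousOn hf hg hu ht
    (hzc.mono Icc_subset_Ici_self), by rw [hz0]; exact hzsol t ht⟩⟩, hz0⟩, ?_⟩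
  intro z' hz' hz'0 t ht
  exact T.eqOn_Icc_of_solution hf hg hu (τ := t) (hzc.mono Icc_subset_Ici_self)
    (hz'.1.mono Icc_subset_Ici_self) (fun s hs => hzsol s hs.1)
    (fun s hs => by rw [← hz'0]; exact (hz'.2 s hs.1).2) ⟨ht, le_rfl⟩

end C0Semigroup

/-! ### Comparison functions -/

lemma isClassK_of_strictMonoOn {f : ℝ → ℝ} (hc : ContinuousOn f (Ici 0)) (h0 : f 0 = 0)
    (hmono : StrictMonoOn f (Ici 0)) : IsClassK f :=
  ⟨⟨hc, h0, fun _ hr => h0 ▸ hmono (mem_Ici.2 le_rfl) (mem_Ici.2 hr.le) hr⟩, hmono⟩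

namespace IsClassK

variable {γ γ' : ℝ → ℝ}

lemma nonneg (hγ : IsClassK γ) {r : ℝ} (hr : 0 ≤ r) : 0 ≤ γ r := by
  rcases hr.eq_or_lt with rfl | h
  · exact hγ.1.2.1.ge
  · exact (hγ.1.2.2 r h).le

lemma add (hγ : IsClassK γ) (hγ' : IsClassK γ') : IsClassK (fun r => γ r + γ' r) :=
  isClassK_of_strictMonoOn (hγ.1.1.add hγ'.1.1)
    (by simp only [hγ.1.2.1, hγ'.1.2.1, add_zero]) (hγ.2.add hγ'.2)

lemma id : IsClassK (fun r => r) :=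
  isClassK_of_strictMonoOn continuousOn_id rfl (strictMono_id.strictMonoOn _)

/-- A class `K` function evaluated along an exponentially decaying linear bound is of class
`KL`. -/
lemma isClassKL_comp_exp (hγ : IsClassK γ) {M lam : ℝ} (hM : 0 < M) (hlam : 0 < lam) :
    IsClassKL (fun r t => γ (M * r * Real.exp (-lam * t))) := by
  have hmaps {r : ℝ} (hr : 0 ≤ r) (t : ℝ) : M * r * Real.exp (-lam * t) ∈ Ici (0 : ℝ) := by
    rw [mem_Ici]; positivity
  refine ⟨?_, fun t _ => ?_, fun r hr => ⟨?_, ?_, ?_⟩⟩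
  · refine hγ.1.1.comp (f := fun p : ℝ × ℝ => M * p.1 * Real.exp (-lam * p.2)) (by fun_prop) ?_
    exact fun p hp => hmaps hp.1 p.2
  · refine isClassK_of_strictMonoOn ?_ (by simpa using hγ.1.2.1) ?_
    · exact hγ.1.1.comp (f := fun r => M * r * Real.exp (-lam * t)) (by fun_prop)
        (fun r hr => hmaps hr t)
    · intro a ha b hb hab
      exact hγ.2 (hmaps ha t) (hmaps hb t) (by gcongr)
  · exact hγ.1.1.comp (f := fun t => M * r * Real.exp (-lam * t)) (by fun_prop)
      (fun t _ => hmaps hr.le t)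
  · intro a _ b _ hab
    refine hγ.2 (hmaps hr.le b) (hmaps hr.le a) ?_
    have : Real.exp (-lam * b) < Real.exp (-lam * a) := Real.exp_lt_exp.2 (by nlinarith)
    gcongr
  · have h1 : Tendsto (fun t => M * r * Real.exp (-lam * t)) atTop (𝓝[≥] 0) := by
      refine tendsto_nhdsWithin_iff.2 ⟨?_, Eventually.of_forall fun t => hmaps hr.le t⟩
      have : Tendsto (fun t => Real.exp (-lam * t)) atTop (𝓝 0) :=
        Real.tendsto_exp_atBot.comp ((tendsto_const_mul_atBot_of_neg (by linarith)).2 tendsto_id)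
      simpa using this.const_mul (M * r)
    have h2 := hγ.1.1 0 (mem_Ici.2 le_rfl)
    rw [ContinuousWithinAt, hγ.1.2.1] at h2
    exact h2.comp h1

lemma continuousWithinAt_comp_norm (hγ : IsClassK γ) {U : Type*} [NormedAddCommGroup U]
    {u : ℝ → U} (hu : IsPCb u) {s : ℝ} (hs : 0 ≤ s) :
    ContinuousWithinAt (fun s => γ ‖u s‖) (Ici s) s :=
  (hγ.1.1 ‖u s‖ (norm_nonneg _)).comp (f := fun s => ‖u s‖) (hu.right_continuous s hs).norm
    (fun _ _ => norm_nonneg _)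

lemma integrableOn_comp_norm (hγ : IsClassK γ) {U : Type*} [NormedAddCommGroup U]
    {u : ℝ → U} (hu : IsPCb u) (τ : ℝ) : IntegrableOn (fun s => γ ‖u s‖) (Icc 0 τ) := by
  rw [integrableOn_Icc_iff_integrableOn_Ioc]
  have hc : Continuous fun r => γ (max r 0) :=
    hγ.1.1.comp_continuous (by fun_prop) (fun r => mem_Ici.2 (le_max_right _ _))
  refine Integrable.of_bound (C := γ (pcbNorm u)) ?_ ?_
  · refine (hc.comp_aestronglyMeasurable (hu.aestronglyMeasurable τ).norm).congr
      (Eventually.of_forall fun s => ?_)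
    simp
  · refine (ae_restrict_iff' measurableSet_Ioc).2 (Eventually.of_forall fun s hs => ?_)
    rw [Real.norm_of_nonneg (hγ.nonneg (norm_nonneg _))]
    exact hγ.2.monotoneOn (mem_Ici.2 (norm_nonneg _)) (mem_Ici.2 hu.pcbNorm_nonneg)
      (hu.norm_le_pcbNorm hs.1.le)

lemma intervalIntegrable_comp_norm (hγ : IsClassK γ) {U : Type*} [NormedAddCommGroup U]
    {u : ℝ → U} (hu : IsPCb u) {t : ℝ} (ht : 0 ≤ t) :
    IntervalIntegrable (fun s => γ ‖u s‖) volume 0 t :=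
  (intervalIntegrable_iff_integrableOn_Icc_of_le ht).2 (hγ.integrableOn_comp_norm hu t)

lemma integral_comp_norm_nonneg (hγ : IsClassK γ) {U : Type*} [NormedAddCommGroup U]
    (u : ℝ → U) {t : ℝ} (ht : 0 ≤ t) : 0 ≤ ∫ s in (0 : ℝ)..t, γ ‖u s‖ :=
  intervalIntegral.integral_nonneg ht fun _ _ => hγ.nonneg (norm_nonneg _)

end IsClassK

/-- The state part left by Young's inequality in the iISS estimate. -/
lemma isClassK_add_sq_div_two : IsClassK (fun r => r + r ^ 2 / 2) := by
  refine isClassK_of_strictMonoOn (by fun_prop) (by simp) ?_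
  intro a ha b _ hab
  have ha' : (0 : ℝ) ≤ a := ha
  dsimp only
  gcongr

/-- The input part of the iISS estimate: the square comes from Young's inequality, the other summand
from `B`. The square alone is unbounded, so `b = 0` is allowed. -/
lemma isClassKInf_exp_gain {M b : ℝ} (hM : 0 < M) (hb : 0 ≤ b) :
    IsClassKInf (fun r => (Real.exp (M * r) - 1) ^ 2 / 2 + b * r * Real.exp (M * r)) := by
  refine ⟨isClassK_of_strictMonoOn (by fun_prop) (by simp) ?_, fun c => ?_⟩
  · intro r hr s _ hrs
    have hr' : (0 : ℝ) ≤ r := hr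
    have h1 : 0 ≤ Real.exp (M * r) - 1 := by
      linarith [Real.add_one_le_exp (M * r), mul_nonneg hM.le hr']
    dsimp only
    have hs' : 0 ≤ b * s := mul_nonneg hb (hr'.trans hrs.le)
    refine add_lt_add_of_lt_of_le ?_ ?_ <;> gcongr
  · refine ⟨(|c| + 2) / M, by positivity, ?_⟩
    dsimp only
    have e : M * ((|c| + 2) / M) = |c| + 2 := by field_simp
    rw [e]
    have h1 : |c| + 2 ≤ Real.exp (|c| + 2) - 1 := by linarith [Real.add_one_le_exp (|c| + 2)]
    have h2 : 0 ≤ b * ((|c| + 2) / M) * Real.exp (|c| + 2) := by positivity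
    nlinarith [le_abs_self c, abs_nonneg c]

/-- The extra `r` keeps the gain strictly increasing and unbounded when `B = 0`. -/
lemma isClassKInf_mul_add {b : ℝ} (hb : 0 ≤ b) : IsClassKInf (fun r => b * r + r) := by
  refine ⟨isClassK_of_strictMonoOn (by fun_prop) (by simp) ?_, fun c => ?_⟩
  · intro r hr s _ hrs
    dsimp only
    exact add_lt_add_of_le_of_lt (by gcongr) hrs
  · refine ⟨|c| + 1, by positivity, ?_⟩
    dsimp only
    have : 0 ≤ b * (|c| + 1) := by positivity
    linarith [le_abs_self c]

/-! ### Bilinear systems -/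

section Bilinear

variable {𝕜 X U : Type*} [RCLike 𝕜] [NormedAddCommGroup X] [NormedSpace 𝕜 X]
  [NormedAddCommGroup U] [NormedSpace 𝕜 U] {B : U →L[𝕜] X} {C : X → U → X} {ξ : ℝ → ℝ}

lemma isAdmissibleNonlinearity_bilinearRHS (hC : IsAdmissibleNonlinearity C) :
    IsAdmissibleNonlinearity (bilinearRHS B C) := by
  refine ⟨fun r hr => ?_, fun x => B.continuous.add (hC.2 x)⟩
  obtain ⟨L, hL, h⟩ := hC.1 r hr
  refine ⟨L, hL, fun x y v hx hy hv => ?_⟩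
  simpa [bilinearRHS] using h x y v hx hy hv

lemma norm_bilinearRHS_le (hCξ : ∀ (x : X) (v : U), ‖C x v‖ ≤ ‖x‖ * ξ ‖v‖) (x : X) (v : U) :
    ‖bilinearRHS B C x v‖ ≤ ‖B‖ * ‖v‖ + ‖x‖ * ξ ‖v‖ :=
  (norm_add_le _ _).trans (add_le_add (B.le_opNorm v) (hCξ x v))

lemma hasLinearGrowth_bilinearRHS (hξ : IsClassK ξ)
    (hCξ : ∀ (x : X) (v : U), ‖C x v‖ ≤ ‖x‖ * ξ ‖v‖) : HasLinearGrowth (bilinearRHS B C) := by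
  intro K
  have hξK := hξ.nonneg (le_max_right K 0)
  refine ⟨‖B‖ * max K 0 + ξ (max K 0), by positivity, fun x v hv => ?_⟩
  have hv' : ‖v‖ ≤ max K 0 := hv.trans (le_max_left _ _)
  have h1 : ξ ‖v‖ ≤ ξ (max K 0) :=
    hξ.2.monotoneOn (mem_Ici.2 (norm_nonneg _)) (mem_Ici.2 (le_max_right _ _)) hv'
  calc ‖bilinearRHS B C x v‖ ≤ ‖B‖ * ‖v‖ + ‖x‖ * ξ ‖v‖ := norm_bilinearRHS_le hCξ x v
    _ ≤ ‖B‖ * max K 0 + ‖x‖ * ξ (max K 0) := by gcongr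
    _ ≤ (‖B‖ * max K 0 + ξ (max K 0)) * (1 + ‖x‖) := by
      nlinarith [mul_nonneg (mul_nonneg (norm_nonneg B) (le_max_right K 0)) (norm_nonneg x)]

lemma bilinearRHS_zero (hξ : IsClassK ξ)
    (hCξ : ∀ (x : X) (v : U), ‖C x v‖ ≤ ‖x‖ * ξ ‖v‖) (x : X) : bilinearRHS B C x 0 = 0 := by
  have := norm_bilinearRHS_le (B := B) hCξ x 0
  rwa [norm_zero, hξ.1.2.1, mul_zero, mul_zero, add_zero, norm_le_zero_iff] at this

end Bilinear

/-! ### Flow estimates: iISS, small-input ISS and zero-input stability -/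

section Flow

variable {𝕜 X U : Type*} [RCLike 𝕜] [NormedAddCommGroup X] [NormedSpace 𝕜 X] [NormedSpace ℝ X]
  [NormedAddCommGroup U] {T : C0Semigroup 𝕜 X} {f : X → U → X}

lemma IsForwardComplete.exists_eq_mildFlow (h : IsForwardComplete T f) (x : X) {u : ℝ → U}
    (hu : IsPCb u) :
    ∃ z, IsMildSolution T f u z ∧ z 0 = x ∧ ∀ t, mildFlow T f t x u = z t := by
  obtain ⟨z, hz, -⟩ := h x u hu
  have hex : ∃ z, IsMildSolution T f u z ∧ z 0 = x := ⟨z, hz⟩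
  exact ⟨hex.choose, hex.choose_spec.1, hex.choose_spec.2, fun t => by
    rw [mildFlow, dif_pos hex]⟩

lemma IsForwardComplete.mildFlow_zero_input (h : IsForwardComplete T f) (hf : ∀ x, f x 0 = 0)
    (x : X) {t : ℝ} (ht : 0 ≤ t) : mildFlow T f t x 0 = T t x := by
  obtain ⟨z, hz, hz0, hzt⟩ := h.exists_eq_mildFlow x IsPCb.zero
  rw [hzt, (hz.2 t ht).2, hz0]
  simp [hf]

omit [NormedAddCommGroup U] in
-- The factor `exp (lam * t)` cancels the decay of `T (t - s)` up to `exp (lam * s)`, leaving an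
-- inequality in the form that Grönwall requires.
lemma IsMildSolution.exp_mul_norm_le {M lam t : ℝ} {u : ℝ → U} {z : ℝ → X} {b : ℝ → ℝ}
    (hT : ∀ t, 0 ≤ t → ‖T t‖ ≤ M * Real.exp (-lam * t)) (hz : IsMildSolution T f u z)
    (ht : 0 ≤ t) (hb : ∀ s ∈ Ioc 0 t, ‖f (z s) (u s)‖ ≤ b s)
    (hbi : IntervalIntegrable b volume 0 t) :
    Real.exp (lam * t) * ‖z t‖ ≤
      M * ‖z 0‖ + M * ∫ s in (0 : ℝ)..t, Real.exp (lam * s) * b s := by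
  have hexp : Real.exp (lam * t) * Real.exp (-lam * t) = 1 := by
    rw [← Real.exp_add]; simp
  have h1 : ‖T t (z 0)‖ ≤ M * Real.exp (-lam * t) * ‖z 0‖ :=
    (T t).le_of_opNorm_le (hT t ht) _
  have h2 : ‖∫ s in (0 : ℝ)..t, T (t - s) (f (z s) (u s))‖ ≤
      ∫ s in (0 : ℝ)..t, (M * Real.exp (-lam * t)) * (Real.exp (lam * s) * b s) := by
    refine intervalIntegral.norm_integral_le_of_norm_le ht
      (Eventually.of_forall fun s hs => ?_) ?_
    · refine ((T _).le_of_opNorm_le_of_le (hT _ (by linarith [hs.2])) (hb s hs)).trans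
        (le_of_eq ?_)
      have : Real.exp (-lam * (t - s)) = Real.exp (-lam * t) * Real.exp (lam * s) := by
        rw [← Real.exp_add]; ring_nf
      rw [this]; ring
    · exact (hbi.continuousOn_mul (Continuous.continuousOn (by fun_prop))).const_mul _
  rw [intervalIntegral.integral_const_mul] at h2
  have h3 : ‖z t‖ ≤ ‖T t (z 0)‖ + ‖∫ s in (0 : ℝ)..t, T (t - s) (f (z s) (u s))‖ := by
    conv_lhs => rw [(hz.2 t ht).2]
    exact norm_add_le _ _
  calc Real.exp (lam * t) * ‖z t‖ ≤ Real.exp (lam * t) * (M * Real.exp (-lam * t) * ‖z 0‖ +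
        M * Real.exp (-lam * t) * ∫ s in (0 : ℝ)..t, Real.exp (lam * s) * b s) := by
        gcongr; linarith
    _ = (Real.exp (lam * t) * Real.exp (-lam * t)) *
        (M * ‖z 0‖ + M * ∫ s in (0 : ℝ)..t, Real.exp (lam * s) * b s) := by ring
    _ = _ := by rw [hexp, one_mul]

variable [NormedSpace 𝕜 U] {B : U →L[𝕜] X} {C : X → U → X} {ξ : ℝ → ℝ}

lemma IsMildSolution.norm_le_iISS {M lam t : ℝ} {u : ℝ → U} {z : ℝ → X} (hM : 0 < M)
    (hlam : 0 < lam) (hT : ∀ t, 0 ≤ t → ‖T t‖ ≤ M * Real.exp (-lam * t)) (hξ : IsClassK ξ)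
    (hCξ : ∀ (x : X) (v : U), ‖C x v‖ ≤ ‖x‖ * ξ ‖v‖) (hu : IsPCb u)
    (hz : IsMildSolution T (bilinearRHS B C) u z) (ht : 0 ≤ t) :
    ‖z t‖ ≤ (M * ‖z 0‖ * Real.exp (-lam * t) + M * ‖B‖ * ∫ s in (0 : ℝ)..t, ‖u s‖) *
      Real.exp (M * ∫ s in (0 : ℝ)..t, ξ ‖u s‖) := by
  have hun {t' : ℝ} (ht' : 0 ≤ t') : IntervalIntegrable (fun s => ‖u s‖) volume 0 t' :=
    IsClassK.id.intervalIntegrable_comp_norm hu ht'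
  have hexpc : Continuous fun s => Real.exp (lam * s) := by fun_prop
  have hy : ContinuousOn (fun s => Real.exp (lam * s) * ‖z s‖) (Icc 0 t) :=
    hexpc.continuousOn.mul (hz.1.mono Icc_subset_Ici_self).norm
  -- Grönwall needs a constant `a`, so the contribution of `B` is replaced by its bound at the final
  -- time `t`; the factor `exp (lam * t)` cancels at the end.
  have key := le_mul_exp_integral_of_le_add_integral
    (a := M * ‖z 0‖ + M * (‖B‖ * (Real.exp (lam * t) * ∫ s in (0 : ℝ)..t, ‖u s‖)))
    (k := fun s => M * ξ ‖u s‖) hy ((hξ.integrableOn_comp_norm hu t).const_mul M)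
    (fun s hs => continuousWithinAt_const.mul (hξ.continuousWithinAt_comp_norm hu hs.1))
    (fun s _ => mul_nonneg hM.le (hξ.nonneg (norm_nonneg _)))
    (fun t' ht' => by
      have hsub : Icc 0 t' ⊆ Icc 0 t := Icc_subset_Icc_right ht'.2
      have hzξ : IntervalIntegrable (fun s => ‖z s‖ * ξ ‖u s‖) volume 0 t' :=
        (hξ.intervalIntegrable_comp_norm hu ht'.1).continuousOn_mul
          (by rw [uIcc_of_le ht'.1]; exact (hz.1.mono Icc_subset_Ici_self).norm)
      have h1 := hz.exp_mul_norm_le hT ht'.1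
        (b := fun s => ‖B‖ * ‖u s‖ + ‖z s‖ * ξ ‖u s‖)
        (fun s _ => norm_bilinearRHS_le hCξ _ _) (((hun ht'.1).const_mul _).add hzξ)
      have h2 : ∫ s in (0 : ℝ)..t', Real.exp (lam * s) * (‖B‖ * ‖u s‖ + ‖z s‖ * ξ ‖u s‖) =
          ‖B‖ * (∫ s in (0 : ℝ)..t', Real.exp (lam * s) * ‖u s‖) +
          ∫ s in (0 : ℝ)..t', ξ ‖u s‖ * (Real.exp (lam * s) * ‖z s‖) := by
        rw [← intervalIntegral.integral_const_mul, ← intervalIntegral.integral_add]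
        · exact intervalIntegral.integral_congr fun s _ => by ring
        · exact ((hun ht'.1).continuousOn_mul hexpc.continuousOn).const_mul _
        · exact (hξ.intervalIntegrable_comp_norm hu ht'.1).mul_continuousOn
            (by rw [uIcc_of_le ht'.1]; exact hy.mono hsub)
      have h3 : ∫ s in (0 : ℝ)..t', Real.exp (lam * s) * ‖u s‖ ≤
          Real.exp (lam * t) * ∫ s in (0 : ℝ)..t, ‖u s‖ := by
        calc ∫ s in (0 : ℝ)..t', Real.exp (lam * s) * ‖u s‖
            ≤ ∫ s in (0 : ℝ)..t', Real.exp (lam * t) * ‖u s‖ := by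
              refine intervalIntegral.integral_mono_on ht'.1
                ((hun ht'.1).continuousOn_mul hexpc.continuousOn) ((hun ht'.1).const_mul _)
                fun s hs => ?_
              gcongr
              exact hs.2.trans ht'.2
          _ = Real.exp (lam * t) * ∫ s in (0 : ℝ)..t', ‖u s‖ :=
              intervalIntegral.integral_const_mul _ _
          _ ≤ _ := by
              gcongr
              exact intervalIntegral.integral_mono_interval le_rfl ht'.1 ht'.2
                (Eventually.of_forall fun s => norm_nonneg _) (hun ht)
      have h4 : ∫ s in (0 : ℝ)..t', M * ξ ‖u s‖ * (Real.exp (lam * s) * ‖z s‖) =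
          M * ∫ s in (0 : ℝ)..t', ξ ‖u s‖ * (Real.exp (lam * s) * ‖z s‖) := by
        rw [← intervalIntegral.integral_const_mul]
        exact intervalIntegral.integral_congr fun s _ => by ring
      rw [h2, mul_add] at h1
      rw [h4]
      have h5 := mul_le_mul_of_nonneg_left (mul_le_mul_of_nonneg_left h3 (norm_nonneg B)) hM.le
      linarith)
  have h1 := key t ⟨ht, le_rfl⟩
  rw [intervalIntegral.integral_const_mul] at h1
  have hexp : Real.exp (-lam * t) * Real.exp (lam * t) = 1 := by
    rw [← Real.exp_add]; simp
  calc ‖z t‖ = Real.exp (-lam * t) * (Real.exp (lam * t) * ‖z t‖) := by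
        rw [← mul_assoc, hexp, one_mul]
    _ ≤ Real.exp (-lam * t) * _ := mul_le_mul_of_nonneg_left h1 (Real.exp_pos _).le
    _ = (M * ‖z 0‖ * Real.exp (-lam * t) +
          M * ‖B‖ * (Real.exp (-lam * t) * Real.exp (lam * t)) * ∫ s in (0 : ℝ)..t, ‖u s‖) *
          Real.exp (M * ∫ s in (0 : ℝ)..t, ξ ‖u s‖) := by ring
    _ = _ := by rw [hexp, mul_one]

theorem isIISS_of_isExponentiallyStable (hfc : IsForwardComplete T (bilinearRHS B C))
    (hξ : IsClassK ξ) (hCξ : ∀ (x : X) (v : U), ‖C x v‖ ≤ ‖x‖ * ξ ‖v‖)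
    (hT : T.IsExponentiallyStable) : IsIISS (mildFlow T (bilinearRHS B C)) := by
  obtain ⟨M, lam, hM, hlam, hT⟩ := hT
  refine ⟨_, _, _, isClassKInf_exp_gain (b := M * ‖B‖) hM (by positivity), IsClassK.id.add hξ,
    isClassK_add_sq_div_two.isClassKL_comp_exp hM hlam, fun t x u ht hu => ?_⟩
  obtain ⟨z, hz, hz0, hzt⟩ := hfc.exists_eq_mildFlow x hu
  have h1 := hz.norm_le_iISS hM hlam hT hξ hCξ hu ht
  rw [hzt]
  rw [hz0] at h1
  rw [intervalIntegral.integral_add (IsClassK.id.intervalIntegrable_comp_norm hu ht)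
    (hξ.intervalIntegrable_comp_norm hu ht)]
  have hN := IsClassK.id.integral_comp_norm_nonneg u ht
  have hJ := hξ.integral_comp_norm_nonneg u ht
  set N := ∫ s in (0 : ℝ)..t, ‖u s‖
  set J := ∫ s in (0 : ℝ)..t, ξ ‖u s‖
  set p := M * ‖x‖ * Real.exp (-lam * t) with hp
  have hp0 : 0 ≤ p := by positivity
  -- Both integrals are enlarged to `N + J`, the integral of the single function `r + ξ r`.
  have h2 : (p + M * ‖B‖ * N) * Real.exp (M * J) ≤
      (p + M * ‖B‖ * (N + J)) * Real.exp (M * (N + J)) := by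
    gcongr <;> linarith
  -- Young's inequality for `p * (exp (M * (N + J)) - 1)`; the remaining summand `p` stays as it is.
  nlinarith [sq_nonneg (p - (Real.exp (M * (N + J)) - 1))]

lemma IsMildSolution.norm_le_ISS {M lam t : ℝ} {u : ℝ → U} {z : ℝ → X} (hM : 0 < M)
    (hlam : 0 < lam) (hT : ∀ t, 0 ≤ t → ‖T t‖ ≤ M * Real.exp (-lam * t))
    (hCξ : ∀ (x : X) (v : U), ‖C x v‖ ≤ ‖x‖ * ξ ‖v‖) (hu : IsPCb u)
    (hsmall : ∀ s, 0 ≤ s → M * ξ ‖u s‖ ≤ lam / 2)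
    (hz : IsMildSolution T (bilinearRHS B C) u z) (ht : 0 ≤ t) :
    ‖z t‖ ≤ M * ‖z 0‖ * Real.exp (-(lam / 2) * t) + 2 * M * ‖B‖ / lam * pcbNorm u := by
  -- The level at which the forcing `M * ‖B‖ * pcbNorm u` balances the decay rate `lam / 2` that is
  -- left after the bilinear term. Grönwall is applied to the excess `‖z‖ - c`, which may be
  -- negative.
  set c := 2 * M * ‖B‖ / lam * pcbNorm u with hc
  have hP := hu.pcbNorm_nonneg
  have hc0 : 0 ≤ c := by positivity
  have hcl : M * (‖B‖ * pcbNorm u) = lam / 2 * c := by rw [hc]; field_simp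
  have hexpc : Continuous fun s => Real.exp (lam * s) := by fun_prop
  have hzc : ContinuousOn (fun s => ‖z s‖) (Icc 0 t) := (hz.1.mono Icc_subset_Ici_self).norm
  have hy : ContinuousOn (fun s => Real.exp (lam * s) * (‖z s‖ - c)) (Icc 0 t) :=
    hexpc.continuousOn.mul (hzc.sub continuousOn_const)
  have key := le_mul_exp_of_le_add_mul_integral (a := M * ‖z 0‖) (k := lam / 2) (by positivity)
    hy (fun t' ht' => by
      have hsub : Icc 0 t' ⊆ Icc 0 t := Icc_subset_Icc_right ht'.2
      have hzi : IntervalIntegrable (fun s => ‖z s‖) volume 0 t' :=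
        (hzc.mono hsub).intervalIntegrable_of_Icc ht'.1
      have hyi : IntervalIntegrable (fun s => Real.exp (lam * s) * (‖z s‖ - c)) volume 0 t' :=
        (hy.mono hsub).intervalIntegrable_of_Icc ht'.1
      have h1 := hz.exp_mul_norm_le hT ht'.1
        (b := fun s => ‖B‖ * pcbNorm u + lam / (2 * M) * ‖z s‖)
        (fun s hs => by
          refine (norm_bilinearRHS_le hCξ _ _).trans ?_
          have h1 : ξ ‖u s‖ ≤ lam / (2 * M) := by
            rw [le_div_iff₀ (by positivity)]
            linarith [hsmall s hs.1.le]
          have h2 := hu.norm_le_pcbNorm hs.1.le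
          rw [mul_comm (lam / (2 * M))]
          gcongr)
        (intervalIntegrable_const.add (hzi.const_mul _))
      have h2 : M * ∫ s in (0 : ℝ)..t', Real.exp (lam * s) *
          (‖B‖ * pcbNorm u + lam / (2 * M) * ‖z s‖) =
          c * (lam * ∫ s in (0 : ℝ)..t', Real.exp (lam * s)) +
          lam / 2 * ∫ s in (0 : ℝ)..t', Real.exp (lam * s) * (‖z s‖ - c) := by
        rw [← intervalIntegral.integral_const_mul, ← intervalIntegral.integral_const_mul,
          ← intervalIntegral.integral_const_mul, ← intervalIntegral.integral_const_mul,
          ← intervalIntegral.integral_add ((hexpc.intervalIntegrable _ _).const_mul _ |>.const_mul _)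
          (hyi.const_mul _)]
        refine intervalIntegral.integral_congr fun s _ => ?_
        have : M * (lam / (2 * M)) = lam / 2 := by field_simp
        linear_combination Real.exp (lam * s) * hcl + Real.exp (lam * s) * ‖z s‖ * this
      rw [h2, integral_exp_const_mul hlam.ne', mul_div_cancel₀ _ hlam.ne'] at h1
      linarith)
  have h1 := key t ⟨ht, le_rfl⟩
  have hexp : Real.exp (-lam * t) * Real.exp (lam * t) = 1 := by
    rw [← Real.exp_add]; simp
  have hexp2 : Real.exp (-lam * t) * Real.exp (lam / 2 * t) = Real.exp (-(lam / 2) * t) := by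
    rw [← Real.exp_add]; ring_nf
  have h2 := mul_le_mul_of_nonneg_left h1 (Real.exp_pos (-lam * t)).le
  rw [← mul_assoc, hexp, one_mul, mul_left_comm, hexp2] at h2
  linarith

theorem isISSSmallInputs_of_isExponentiallyStable
    (hfc : IsForwardComplete T (bilinearRHS B C))
    (hξ : IsClassK ξ) (hCξ : ∀ (x : X) (v : U), ‖C x v‖ ≤ ‖x‖ * ξ ‖v‖)
    (hT : T.IsExponentiallyStable) : IsISSSmallInputs (mildFlow T (bilinearRHS B C)) := by
  obtain ⟨M, lam, hM, hlam, hT⟩ := hT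
  -- Continuity of `ξ` at 0 provides the threshold.
  obtain ⟨R, hR, hRξ⟩ : ∃ R, 0 < R ∧ M * ξ R ≤ lam / 2 := by
    have h1 : Tendsto (fun r => M * ξ r) (𝓝[>] 0) (𝓝 (M * ξ 0)) :=
      ((hξ.1.1 0 (mem_Ici.2 le_rfl)).mono Ioi_subset_Ici_self).tendsto.const_mul M
    rw [hξ.1.2.1, mul_zero] at h1
    obtain ⟨R, hR, hR0⟩ := ((h1.eventually (gt_mem_nhds (half_pos hlam))).and
      self_mem_nhdsWithin).exists
    exact ⟨R, hR0, hR.le⟩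
  refine ⟨_, _, R, IsClassK.id.isClassKL_comp_exp hM (half_pos hlam),
    isClassKInf_mul_add (b := 2 * M * ‖B‖ / lam) (by positivity), hR, fun x u hu huR t ht => ?_⟩
  obtain ⟨z, hz, hz0, hzt⟩ := hfc.exists_eq_mildFlow x hu
  have h1 := hz.norm_le_ISS hM hlam hT hCξ hu (fun s hs => by
    refine le_trans ?_ hRξ
    gcongr
    exact hξ.2.monotoneOn (mem_Ici.2 (norm_nonneg _)) (mem_Ici.2 hR.le)
      ((hu.norm_le_pcbNorm hs).trans huR)) ht
  rw [hzt]
  rw [hz0] at h1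
  linarith [hu.pcbNorm_nonneg]

omit [NormedSpace ℝ X] [NormedSpace 𝕜 U] in
theorem IsIISS.isZeroUGAS {φ : ℝ → X → (ℝ → U) → X} (h : IsIISS φ) : IsZeroUGAS φ := by
  obtain ⟨θ, μ, β, hθ, hμ, hβ, h⟩ := h
  refine ⟨β, hβ, fun x t ht => ?_⟩
  simpa [hμ.1.2.1, hθ.1.1.2.1] using h t x 0 ht IsPCb.zero

omit [NormedSpace 𝕜 U] in
theorem isExponentiallyStable_of_isZeroUGAS [CompleteSpace X] (hfc : IsForwardComplete T f)
    (hf : ∀ x, f x 0 = 0) (h : IsZeroUGAS (mildFlow T f)) : T.IsExponentiallyStable := by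
  obtain ⟨β, hβ, h⟩ := h
  obtain ⟨t₀, ht₀, ht₀'⟩ := (((hβ.2.2 1 one_pos).2.2.eventually
    (gt_mem_nhds (show (0 : ℝ) < 1 / 2 by norm_num))).and (eventually_gt_atTop 0)).exists
  refine T.isExponentiallyStable_of_norm_le_half ht₀' ?_
  refine ContinuousLinearMap.opNorm_le_of_unit_norm (by norm_num) fun x hx => ?_
  have := h x t₀ ht₀'.le
  rw [hfc.mildFlow_zero_input hf x ht₀'.le, hx] at this
  linarith

end Flow

/-! ### The energy of an orbit and Datko's theorem -/

namespace C0Semigroup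

variable {𝕜 X : Type*} [RCLike 𝕜] [NormedAddCommGroup X] [NormedSpace 𝕜 X]
  (T : C0Semigroup 𝕜 X)

/-- The energy `∫₀^∞ ‖T t x‖² dt` of an orbit. -/
noncomputable def energy (x : X) : ℝ :=
  ∫ t in Ioi (0 : ℝ), ‖T t x‖ ^ 2

lemma energy_nonneg (x : X) : 0 ≤ T.energy x :=
  integral_nonneg fun _ => by positivity

lemma logLyapunov_eq (x : X) : logLyapunov T x = Real.log (1 + T.energy x) := rfl

variable [CompleteSpace X]

lemma aestronglyMeasurable_orbit (x : X) :
    AEStronglyMeasurable (fun t => T t x) (volume.restrict (Ioi 0)) :=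
  ((T.continuousOn_apply x).mono Ioi_subset_Ici_self).aestronglyMeasurable measurableSet_Ioi

lemma intervalIntegrable_norm_sq (x : X) {a b : ℝ} (ha : 0 ≤ a) (hab : a ≤ b) :
    IntervalIntegrable (fun t => ‖T t x‖ ^ 2) volume a b :=
  ContinuousOn.intervalIntegrable_of_Icc hab
    (((T.continuousOn_apply x).mono fun _ hs => ha.trans hs.1).norm.pow 2)

omit [CompleteSpace X] in
lemma integral_norm_sq_le_energy {x : X} (hx : IntegrableOn (fun t => ‖T t x‖ ^ 2) (Ioi (0 : ℝ)))
    {a b : ℝ} (ha : 0 ≤ a) (hab : a ≤ b) : ∫ t in a..b, ‖T t x‖ ^ 2 ≤ T.energy x := by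
  rw [intervalIntegral.integral_of_le hab]
  exact setIntegral_mono_set hx (Eventually.of_forall fun _ => by positivity)
    (Eventually.of_forall fun t ht => mem_Ioi.2 (ha.trans_lt ht.1))

lemma energy_pos {x : X} (hx : IntegrableOn (fun t => ‖T t x‖ ^ 2) (Ioi (0 : ℝ))) (hx0 : x ≠ 0) :
    0 < T.energy x := by
  refine lt_of_lt_of_le ?_ (T.integral_norm_sq_le_energy hx le_rfl zero_le_one)
  refine intervalIntegral.integral_pos zero_lt_one
    (((T.continuousOn_apply x).mono Icc_subset_Ici_self).norm.pow 2)
    (fun t _ => by positivity) ⟨0, by simp, ?_⟩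
  rw [T.zero_apply]
  positivity

omit [CompleteSpace X] in
-- By translation, moving along the orbit discards exactly the initial piece of the integral; this
-- is the source of the dissipation.
lemma energy_apply {x : X} (hx : IntegrableOn (fun t => ‖T t x‖ ^ 2) (Ioi (0 : ℝ))) {h : ℝ}
    (hh : 0 ≤ h) : T.energy (T h x) = T.energy x - ∫ t in (0 : ℝ)..h, ‖T t x‖ ^ 2 := by
  have h1 := (measurePreserving_add_right volume h).setIntegral_preimage_emb
    (measurableEmbedding_addRight h) (fun t => ‖T t x‖ ^ 2) (Ioi h)
  have h2 : (fun t => t + h) ⁻¹' Ioi h = Ioi 0 := by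
    ext t; simp
  have h3 : T.energy (T h x) = ∫ t in Ioi (0 : ℝ), ‖T (t + h) x‖ ^ 2 :=
    setIntegral_congr_fun measurableSet_Ioi fun t ht => by
      simp only [T.add_apply (le_of_lt (mem_Ioi.1 ht)) hh]
  rw [h2] at h1
  rw [h3, h1, ← intervalIntegral.integral_Ioi_sub_Ioi hx hh, energy]
  ring

/-- The square root of the energy is subadditive. -/
lemma sqrt_energy_add_le
    (hint : ∀ x, IntegrableOn (fun t => ‖T t x‖ ^ 2) (Ioi (0 : ℝ))) (a b : X) :
    √(T.energy (a + b)) ≤ √(T.energy a) + √(T.energy b) := by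
  have hmem (x : X) : MemLp (fun t => ‖T t x‖) 2 (volume.restrict (Ioi 0)) :=
    (memLp_two_iff_integrable_sq (T.aestronglyMeasurable_orbit x).norm).2 (hint x)
  -- Cauchy–Schwarz for the cross term, as in Minkowski's inequality for `L²`.
  have hCS := integral_mul_le_Lp_mul_Lq_of_nonneg (μ := volume.restrict (Ioi (0 : ℝ)))
    Real.HolderConjugate.two_two (f := fun t => ‖T t a‖) (g := fun t => ‖T t b‖)
    (Eventually.of_forall fun _ => norm_nonneg _) (Eventually.of_forall fun _ => norm_nonneg _)
    (by simpa using hmem a) (by simpa using hmem b)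
  simp only [Real.rpow_two, ← Real.sqrt_eq_rpow] at hCS
  change _ ≤ √(T.energy a) * √(T.energy b) at hCS
  have hprod : IntegrableOn (fun t => ‖T t a‖ * ‖T t b‖) (Ioi (0 : ℝ)) :=
    (hmem a).integrable_mul (hmem b)
  have h1 : T.energy (a + b) ≤
      ∫ t in Ioi (0 : ℝ), (‖T t a‖ ^ 2 + 2 * (‖T t a‖ * ‖T t b‖) + ‖T t b‖ ^ 2) := by
    refine setIntegral_mono (hint _) (((hint a).add (hprod.const_mul 2)).add (hint b))
      fun t => ?_
    have : ‖T t (a + b)‖ ≤ ‖T t a‖ + ‖T t b‖ := by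
      rw [_root_.map_add]; exact norm_add_le _ _
    calc ‖T t (a + b)‖ ^ 2 ≤ (‖T t a‖ + ‖T t b‖) ^ 2 := by gcongr
      _ = _ := by ring
  have h2 : ∫ t in Ioi (0 : ℝ), (‖T t a‖ ^ 2 + 2 * (‖T t a‖ * ‖T t b‖) + ‖T t b‖ ^ 2) =
      T.energy a + 2 * (∫ t in Ioi (0 : ℝ), ‖T t a‖ * ‖T t b‖) + T.energy b := by
    rw [energy, energy, ← integral_const_mul, ← integral_add (hint a) (hprod.const_mul 2)]
    exact integral_add ((hint a).add (hprod.const_mul 2)) (hint b)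
  refine Real.sqrt_le_iff.2 ⟨by positivity, ?_⟩
  nlinarith [Real.sq_sqrt (T.energy_nonneg a), Real.sq_sqrt (T.energy_nonneg b)]

/-- Datko's theorem for a uniform bound on the energy of unit vectors. -/
theorem isExponentiallyStable_of_energy_le
    (hint : ∀ x, IntegrableOn (fun t => ‖T t x‖ ^ 2) (Ioi (0 : ℝ))) {K : ℝ} (hK : 0 ≤ K)
    (hbound : ∀ x, ‖x‖ = 1 → T.energy x ≤ K) : T.IsExponentiallyStable := by
  -- For `s` in `[a, t]` one has `‖T t x‖ ≤ N * ‖T s x‖`; integrating the squares over `s` brings in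
  -- the energy.
  have key {N a t : ℝ} (ha : 0 ≤ a) (hat : a ≤ t) (hN : ∀ s ∈ Icc 0 (t - a), ‖T s‖ ≤ N)
      {x : X} (hx : ‖x‖ = 1) : (t - a) * ‖T t x‖ ^ 2 ≤ N ^ 2 * K := by
    have hN0 : 0 ≤ N := (norm_nonneg _).trans (hN 0 ⟨le_rfl, by linarith⟩)
    calc (t - a) * ‖T t x‖ ^ 2 = ∫ _ in a..t, ‖T t x‖ ^ 2 := by simp
      _ ≤ ∫ s in a..t, N ^ 2 * ‖T s x‖ ^ 2 := by
        refine intervalIntegral.integral_mono_on hat (by simp)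
          ((T.intervalIntegrable_norm_sq x ha hat).const_mul _) fun s hs => ?_
        have h1 : T t x = T (t - s) (T s x) := by
          rw [← T.add_apply (by linarith [hs.2]) (ha.trans hs.1), sub_add_cancel]
        rw [h1, ← mul_pow]
        gcongr
        exact (T _).le_of_opNorm_le (hN _ ⟨by linarith [hs.2], by linarith [hs.1]⟩) _
      _ = N ^ 2 * ∫ s in a..t, ‖T s x‖ ^ 2 := intervalIntegral.integral_const_mul _ _
      _ ≤ N ^ 2 * K := by
        gcongr
        exact (T.integral_norm_sq_le_energy (hint x) ha hat).trans (hbound x hx)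
  obtain ⟨M, hM1, hM⟩ := T.exists_bound 1
  have hbdd : ∀ t, 0 ≤ t → ‖T t‖ ≤ M * (K + 1) := by
    intro t ht
    refine ContinuousLinearMap.opNorm_le_of_unit_norm (by positivity) fun x hx => ?_
    rcases le_total t 1 with h | h
    · have := (T t).le_of_opNorm_le (hM t ⟨ht, h⟩) x
      rw [hx] at this
      nlinarith
    -- A window of length one needs only the bound on `[0, 1]`, and yields a bound uniform in time.
    · have h1 := key (N := M) (a := t - 1) (t := t) (by linarith) (by linarith)
        (by simpa using hM) hx
      rw [sub_sub_cancel, one_mul] at h1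
      refine abs_le_of_sq_le_sq' ?_ (by positivity) |>.2
      rw [mul_pow]
      refine h1.trans ?_
      gcongr
      nlinarith
  set N := M * (K + 1)
  -- With the uniform bound the window can be all of `[0, t₀]`; this `t₀` makes `N ^ 2 * K / t₀` at
  -- most 1/4.
  have ht₀ : 0 < 4 * (N ^ 2 * K) + 1 := by positivity
  refine T.isExponentiallyStable_of_norm_le_half ht₀ ?_
  refine ContinuousLinearMap.opNorm_le_of_unit_norm (by norm_num) fun x hx => ?_
  have h1 := key (N := N) (a := 0) le_rfl ht₀.le (fun s hs => hbdd s hs.1) hx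
  rw [sub_zero] at h1
  refine abs_le_of_sq_le_sq' ?_ (by norm_num) |>.2
  have h2 : 0 ≤ N ^ 2 * K := by positivity
  nlinarith [sq_nonneg ‖T (4 * (N ^ 2 * K) + 1) x‖]

section Stable

variable {T} {M lam : ℝ} (hlam : 0 < lam)
  (hT : ∀ t, 0 ≤ t → ‖T t‖ ≤ M * Real.exp (-lam * t))

include hT in
omit [CompleteSpace X] in
lemma norm_sq_apply_le (x : X) {t : ℝ} (ht : 0 ≤ t) :
    ‖T t x‖ ^ 2 ≤ M ^ 2 * ‖x‖ ^ 2 * Real.exp (-(2 * lam) * t) := by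
  have h1 := (T t).le_of_opNorm_le (hT t ht) x
  have h2 : Real.exp (-(2 * lam) * t) = Real.exp (-lam * t) ^ 2 := by
    rw [← Real.exp_nat_mul]; push_cast; ring_nf
  calc ‖T t x‖ ^ 2 ≤ (M * Real.exp (-lam * t) * ‖x‖) ^ 2 := by gcongr
    _ = _ := by rw [h2]; ring

include hlam hT

lemma integrableOn_norm_sq (x : X) : IntegrableOn (fun t => ‖T t x‖ ^ 2) (Ioi (0 : ℝ)) := by
  refine Integrable.mono' ((integrableOn_exp_mul_Ioi (a := -(2 * lam)) (by linarith) 0).const_mul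
    (M ^ 2 * ‖x‖ ^ 2)) ((T.aestronglyMeasurable_orbit x).norm.pow 2) ?_
  refine (ae_restrict_iff' measurableSet_Ioi).2 (Eventually.of_forall fun t ht => ?_)
  rw [Real.norm_of_nonneg (by positivity)]
  exact norm_sq_apply_le hT x (le_of_lt ht)

lemma energy_le (x : X) : T.energy x ≤ M ^ 2 / (2 * lam) * ‖x‖ ^ 2 := by
  have h1 : T.energy x ≤ ∫ t in Ioi (0 : ℝ), M ^ 2 * ‖x‖ ^ 2 * Real.exp (-(2 * lam) * t) :=
    setIntegral_mono_on (integrableOn_norm_sq hlam hT x)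
      ((integrableOn_exp_mul_Ioi (a := -(2 * lam)) (by linarith) 0).const_mul _)
      measurableSet_Ioi fun t ht => norm_sq_apply_le hT x (le_of_lt ht)
  rw [integral_const_mul, integral_exp_mul_Ioi (by linarith)] at h1
  refine h1.trans (le_of_eq ?_)
  rw [mul_zero, Real.exp_zero, neg_div_neg_eq]
  ring

lemma sqrt_energy_le (x : X) : √(T.energy x) ≤ √(M ^ 2 / (2 * lam)) * ‖x‖ := by
  refine (Real.sqrt_le_sqrt (energy_le hlam hT x)).trans (le_of_eq ?_)
  rw [Real.sqrt_mul (by positivity), Real.sqrt_sq (norm_nonneg _)]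

/-- The square root of the energy is subadditive and dominated by a multiple of the norm, hence
Lipschitz. -/
lemma continuous_energy : Continuous T.energy := by
  have hadd := T.sqrt_energy_add_le (integrableOn_norm_sq hlam hT)
  have hlip : LipschitzWith (√(M ^ 2 / (2 * lam))).toNNReal (fun x => √(T.energy x)) := by
    refine LipschitzWith.of_le_add_mul _ fun x y => ?_
    have h1 := hadd y (x - y)
    rw [add_sub_cancel] at h1
    refine h1.trans ?_
    rw [Real.coe_toNNReal _ (Real.sqrt_nonneg _), dist_eq_norm]
    gcongr
    exact sqrt_energy_le hlam hT _
  exact (hlip.continuous.pow 2).congr fun x => Real.sq_sqrt (T.energy_nonneg x)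

end Stable

end C0Semigroup

lemma tendsto_inv_mul_integral {k : ℝ → ℝ} {τ : ℝ} (hτ : 0 < τ)
    (hk : IntegrableOn k (Icc 0 τ)) (hk0 : ContinuousWithinAt k (Ici 0) 0) :
    Tendsto (fun h => (∫ s in (0 : ℝ)..h, k s) / h) (𝓝[>] 0) (𝓝 (k 0)) := by
  have h1 : HasDerivWithinAt (fun t => ∫ r in (0 : ℝ)..t, k r) (k 0) (Ioi 0) 0 := by
    refine (intervalIntegral.integral_hasDerivWithinAt_right (s := Ici 0) (t := Ioi 0) (by simp)
      ⟨Ioc 0 τ, Ioc_mem_nhdsGT hτ, ?_⟩ (hk0.mono Ioi_subset_Ici_self)).mono Ioi_subset_Ici_self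
    exact (hk.mono_set Ioc_subset_Icc_self).aestronglyMeasurable
  rw [hasDerivWithinAt_iff_tendsto_slope' (by simp)] at h1
  refine h1.congr fun h => ?_
  simp [slope_def_field]

/-! ### The logarithmic Lyapunov function -/

section Lyapunov

variable {𝕜 X U : Type*} [RCLike 𝕜] [NormedAddCommGroup X] [NormedSpace 𝕜 X] [NormedSpace ℝ X]
  [CompleteSpace X] [NormedAddCommGroup U] {T : C0Semigroup 𝕜 X} {f : X → U → X} {M lam : ℝ}

/-- Bound on the Lie derivative of the logarithmic Lyapunov function. -/
lemma lieDerivative_logLyapunov_le (hM : 0 < M) (hlam : 0 < lam)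
    (hT : ∀ t, 0 ≤ t → ‖T t‖ ≤ M * Real.exp (-lam * t)) (hfc : IsForwardComplete T f)
    (hf : IsAdmissibleNonlinearity f) (hg : HasLinearGrowth f) (x : X) {u : ℝ → U}
    (hu : IsPCb u) :
    lieDerivative (mildFlow T f) (logLyapunov T) x u ≤
      (((-‖x‖ ^ 2 + 2 * √(T.energy x) * (√(M ^ 2 / (2 * lam)) * M * ‖f x (u 0)‖)) /
        (1 + T.energy x) : ℝ) : EReal) := by
  obtain ⟨z, hz, hz0, hzt⟩ := hfc.exists_eq_mildFlow x hu
  have hint := C0Semigroup.integrableOn_norm_sq hlam hT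
  have hE := T.energy_nonneg x
  -- The root bounds the square root of the energy by the norm; the further `M` bounds the semigroup
  -- inside the convolution.
  set κ := √(M ^ 2 / (2 * lam)) * M
  have hκ : 0 ≤ κ := by positivity
  set I : ℝ → ℝ := fun h => ∫ t in (0 : ℝ)..h, ‖T t x‖ ^ 2
  set G : ℝ → ℝ := fun h => ∫ s in (0 : ℝ)..h, ‖f (z s) (u s)‖
  obtain ⟨K, hK⟩ := hg.exists_bound hu (τ := 1) (hz.1.mono Icc_subset_Ici_self)
  have hgint : IntegrableOn (fun s => ‖f (z s) (u s)‖) (Icc 0 1) := by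
    rw [integrableOn_Icc_iff_integrableOn_Ioc]
    refine Integrable.of_bound (hf.aestronglyMeasurable hu
      (hz.1.mono Icc_subset_Ici_self)).norm K ?_
    refine (ae_restrict_iff' measurableSet_Ioc).2 (Eventually.of_forall fun s hs => ?_)
    simpa using hK s (Ioc_subset_Icc_self hs)
  have hI : Tendsto (fun h => I h / h) (𝓝[>] 0) (𝓝 (‖x‖ ^ 2)) := by
    have := tendsto_inv_mul_integral (k := fun t => ‖T t x‖ ^ 2) one_pos
      (((T.continuousOn_apply x).mono Icc_subset_Ici_self).norm.pow 2).integrableOn_Icc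
      ((T.continuousOn_apply x).norm.pow 2 0 (mem_Ici.2 le_rfl))
    simpa [T.zero_apply] using this
  have hG : Tendsto (fun h => G h / h) (𝓝[>] 0) (𝓝 ‖f x (u 0)‖) := by
    have := tendsto_inv_mul_integral one_pos hgint
      (hf.continuousWithinAt hu le_rfl hz.1).norm
    simpa [hz0] using this
  have hid : Tendsto (fun h : ℝ => h) (𝓝[>] 0) (𝓝 0) := tendsto_id.mono_left nhdsWithin_le_nhds
  -- Limit of the majorant of the difference quotient; the squared convolution term is of order `h ^
  -- 2` and drops out after division by `h`.
  have hlim : Tendsto (fun h => (-(I h / h) + 2 * √(T.energy x) * (κ * (G h / h)) +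
      (κ * (G h / h)) ^ 2 * h) / (1 + T.energy x)) (𝓝[>] 0)
      (𝓝 ((-‖x‖ ^ 2 + 2 * √(T.energy x) * (κ * ‖f x (u 0)‖)) / (1 + T.energy x))) := by
    have := ((hI.neg.add ((hG.const_mul κ).const_mul (2 * √(T.energy x)))).add
      (((hG.const_mul κ).pow 2).mul hid)).div_const (1 + T.energy x)
    simpa using this
  have hlimE := (continuous_coe_real_ereal.tendsto _).comp hlim
  rw [lieDerivative, ← hlimE.limsup_eq]
  refine limsup_le_limsup ?_
  filter_upwards [Ioc_mem_nhdsGT (zero_lt_one (α := ℝ))] with h hh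
  refine EReal.coe_le_coe_iff.2 ?_
  have hh0 : 0 < h := hh.1
  have hTM : ∀ s ∈ Icc 0 h, ‖T s‖ ≤ M := fun s hs =>
    (hT s hs.1).trans (mul_le_of_le_one_right hM.le (Real.exp_le_one_iff.2 (by nlinarith [hs.1])))
  have hw : ‖∫ s in (0 : ℝ)..h, T (h - s) (f (z s) (u s))‖ ≤ M * G h :=
    T.norm_conv_le hh0.le hTM (fun s _ => le_rfl)
      ((intervalIntegrable_iff_integrableOn_Icc_of_le hh0.le).2
        (hgint.mono_set (Icc_subset_Icc_right hh.2)))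
  have hG0 : 0 ≤ G h := intervalIntegral.integral_nonneg hh0.le fun _ _ => norm_nonneg _
  have hI0 : 0 ≤ I h := intervalIntegral.integral_nonneg hh0.le fun _ _ => by positivity
  have hTh : T.energy (T h x) = T.energy x - I h := T.energy_apply (hint x) hh0.le
  -- Subadditivity for `z h = T h x + convolution`: `energy_apply` handles the first term and `κ * G
  -- h` bounds the second.
  have hq : √(T.energy (z h)) ≤ √(T.energy x - I h) + κ * G h := by
    rw [(hz.2 h hh0.le).2, hz0, ← hTh]
    refine (T.sqrt_energy_add_le hint _ _).trans ?_
    gcongr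
    refine (C0Semigroup.sqrt_energy_le hlam hT _).trans ?_
    rw [mul_assoc]
    gcongr
  have hE1 : T.energy (z h) - T.energy x ≤
      -I h + 2 * √(T.energy x) * (κ * G h) + (κ * G h) ^ 2 := by
    have h1 : 0 ≤ T.energy x - I h := hTh ▸ T.energy_nonneg _
    have h2 : √(T.energy x - I h) ≤ √(T.energy x) := Real.sqrt_le_sqrt (by linarith)
    have h3 : T.energy (z h) ≤ (√(T.energy x - I h) + κ * G h) ^ 2 := by
      rw [← Real.sq_sqrt (T.energy_nonneg (z h))]
      gcongr
    have h4 := Real.sq_sqrt h1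
    have h5 : √(T.energy x - I h) * (κ * G h) ≤ √(T.energy x) * (κ * G h) := by gcongr
    nlinarith
  -- Concavity: the logarithm lies below its tangent at `1 + T.energy x`.
  have hlog : logLyapunov T (z h) - logLyapunov T x ≤
      (T.energy (z h) - T.energy x) / (1 + T.energy x) := by
    have hp := T.energy_nonneg (z h)
    rw [T.logLyapunov_eq, T.logLyapunov_eq, ← Real.log_div (by positivity) (by positivity)]
    refine (Real.log_le_sub_one_of_pos (by positivity)).trans (le_of_eq ?_)
    field_simp
    ring
  rw [hzt]
  calc (logLyapunov T (z h) - logLyapunov T x) / h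
      ≤ ((-I h + 2 * √(T.energy x) * (κ * G h) + (κ * G h) ^ 2) / (1 + T.energy x)) / h := by
        gcongr
        refine hlog.trans ?_
        gcongr
    _ = _ := by field_simp

variable [NormedSpace 𝕜 U] {B : U →L[𝕜] X} {C : X → U → X} {ξ : ℝ → ℝ}

theorem isNoncoerciveIISSLyapunov_logLyapunov (hT : T.IsExponentiallyStable)
    (hfc : IsForwardComplete T (bilinearRHS B C)) (hC : IsAdmissibleNonlinearity C)
    (hξ : IsClassK ξ) (hCξ : ∀ (x : X) (v : U), ‖C x v‖ ≤ ‖x‖ * ξ ‖v‖) :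
    (∀ x, IntegrableOn (fun t => ‖T t x‖ ^ 2) (Ioi (0 : ℝ))) ∧
      IsNoncoerciveIISSLyapunov (mildFlow T (bilinearRHS B C)) (logLyapunov T) := by
  obtain ⟨M, lam, hM, hlam, hT⟩ := hT
  have hint := C0Semigroup.integrableOn_norm_sq hlam hT
  have hpos (x : X) : 0 < 1 + T.energy x := by linarith [T.energy_nonneg x]
  set K := M ^ 2 / (2 * lam) with hKdef
  have hK : 0 < K := by positivity
  set κ := √K * M with hκdef
  have hκ : 0 < κ := by positivity
  -- `ψ₂` comes from `energy_le`. In `α`, half of the dissipation `r ^ 2` survives, divided by the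
  -- bound `1 + K * r ^ 2` of `1 + energy`. In `σ` the terms come from `B` and `C`, and the last `r`
  -- ensures strict growth.
  refine ⟨hint, ?_, fun x => Real.log_nonneg (le_add_of_nonneg_right (T.energy_nonneg x)),
    fun r => Real.log (1 + K * r ^ 2), fun r => r ^ 2 / 2 / (1 + K * r ^ 2),
    fun r => κ * ‖B‖ * r + 2 * κ ^ 2 * ξ r ^ 2 + r, ⟨?_, ?_⟩, ⟨?_, by simp, ?_⟩, ?_, ?_, ?_⟩
  · exact (continuous_const.add (C0Semigroup.continuous_energy hlam hT)).log
      fun x => (hpos x).ne'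
  · refine isClassK_of_strictMonoOn ?_ (by simp) ?_
    · exact ContinuousOn.log (by fun_prop) fun r _ => by positivity
    · intro a ha b _ hab
      have ha' : (0 : ℝ) ≤ a := ha
      exact Real.log_lt_log (by positivity) (by gcongr)
  · intro c
    refine ⟨√(Real.exp c / K), Real.sqrt_nonneg _, ?_⟩
    dsimp only
    rw [Real.sq_sqrt (by positivity), mul_div_cancel₀ _ hK.ne', Real.lt_log_iff_exp_lt (by positivity)]
    linarith
  · exact ContinuousOn.div (by fun_prop) (by fun_prop) fun r _ => by positivity
  · intro r hr
    positivity
  · refine isClassK_of_strictMonoOn ?_ (by simp [hξ.1.2.1]) ?_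
    · exact ((Continuous.continuousOn (by fun_prop)).add
        (continuousOn_const.mul (hξ.1.1.pow 2))).add continuousOn_id
    · intro a ha b hb hab
      have h1 := hξ.2.monotoneOn ha hb hab.le
      have h2 := hξ.nonneg ha
      refine add_lt_add_of_le_of_lt ?_ hab
      gcongr
  · intro x hx
    refine ⟨Real.log_pos (lt_add_of_pos_right 1 (T.energy_pos (hint x) hx)), ?_⟩
    exact Real.log_le_log (hpos x) (add_le_add_right (C0Semigroup.energy_le hlam hT x) 1)
  · intro x u hu
    refine (lieDerivative_logLyapunov_le hM hlam hT hfc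
      (isAdmissibleNonlinearity_bilinearRHS hC) (hasLinearGrowth_bilinearRHS hξ hCξ) x hu).trans ?_
    refine EReal.coe_le_coe_iff.2 ?_
    have hEx := C0Semigroup.energy_le hlam hT x
    have hE0 := T.energy_nonneg x
    have hf0 := norm_bilinearRHS_le (B := B) hCξ x (u 0)
    have hξ0 := hξ.nonneg (norm_nonneg (u 0))
    set q := √(T.energy x)
    have hq0 : 0 ≤ q := Real.sqrt_nonneg _
    have hq2 : q ^ 2 = T.energy x := Real.sq_sqrt hE0
    rw [← hKdef, ← hκdef]
    rw [← hq2] at hEx ⊢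
    have h1 : 2 * q * (κ * ‖bilinearRHS B C x (u 0)‖) ≤
        2 * q * (κ * (‖B‖ * ‖u 0‖ + ‖x‖ * ξ ‖u 0‖)) := by gcongr
    -- From `2 * q ≤ 1 + q ^ 2`: the denominator of the logarithmic derivative absorbs the growth in
    -- the state.
    have h2 : 2 * q * (κ * (‖B‖ * ‖u 0‖)) ≤ κ * ‖B‖ * ‖u 0‖ * (1 + q ^ 2) := by
      have : 0 ≤ κ * ‖B‖ * ‖u 0‖ := by positivity
      nlinarith [mul_nonneg this (sq_nonneg (q - 1))]
    -- Young's inequality spends half of the dissipation; the remainder is proportional to `q ^ 2`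
    -- and is again absorbed by the denominator.
    have h3 : 2 * q * (κ * (‖x‖ * ξ ‖u 0‖)) ≤
        ‖x‖ ^ 2 / 2 + 2 * κ ^ 2 * ξ ‖u 0‖ ^ 2 * (1 + q ^ 2) := by
      nlinarith [sq_nonneg (‖x‖ - 2 * q * κ * ξ ‖u 0‖), sq_nonneg (κ * ξ ‖u 0‖)]
    have h4 : ‖x‖ ^ 2 / 2 / (1 + K * ‖x‖ ^ 2) * (1 + q ^ 2) ≤ ‖x‖ ^ 2 / 2 := by
      rw [div_mul_eq_mul_div, div_le_iff₀ (by positivity)]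
      gcongr
    rw [div_le_iff₀ (by positivity)]
    have h5 : 0 ≤ ‖u 0‖ * (1 + q ^ 2) := by positivity
    nlinarith

omit [NormedSpace ℝ X] [NormedSpace 𝕜 U] in
-- On the unit sphere `W ≤ ψ 1` means that the energy is at most `exp (ψ 1)`, which is the uniform
-- bound in Datko's theorem.
theorem IsNoncoerciveIISSLyapunov.isExponentiallyStable {φ : ℝ → X → (ℝ → U) → X}
    (hint : ∀ x, IntegrableOn (fun t => ‖T t x‖ ^ 2) (Ioi (0 : ℝ)))
    (h : IsNoncoerciveIISSLyapunov φ (logLyapunov T)) : T.IsExponentiallyStable := by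
  obtain ⟨-, -, ψ, α, σ, hψ, -, -, hbound, -⟩ := h
  refine T.isExponentiallyStable_of_energy_le hint (Real.exp_pos (ψ 1)).le fun x hx => ?_
  have h1 := (hbound x (by rintro rfl; simp at hx)).2
  have h0 := T.energy_nonneg x
  rw [hx, T.logLyapunov_eq, Real.log_le_iff_le_exp (by positivity)] at h1
  linarith

end Lyapunov

/-! ### The equivalences -/

theorem mainTheorem2 {𝕜 X U : Type*} [RCLike 𝕜]
    [NormedAddCommGroup X] [NormedSpace 𝕜 X] [NormedSpace ℝ X] [IsScalarTower ℝ 𝕜 X]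
    [CompleteSpace X] [NormedAddCommGroup U] [NormedSpace 𝕜 U]
    (A : X →ₗ.[𝕜] X) (T : C0Semigroup 𝕜 X) (hA : T.IsGenerator A)
    (B : U →L[𝕜] X) (C : X → U → X) (hC : IsAdmissibleNonlinearity C)
    (hCξ : ∃ ξ : ℝ → ℝ, IsClassK ξ ∧ ∀ (x : X) (v : U), ‖C x v‖ ≤ ‖x‖ * ξ ‖v‖) :
    IsForwardComplete T (bilinearRHS B C) ∧
      List.TFAE [
        IsStronglyIISS (mildFlow T (bilinearRHS B C)),
        IsIISS (mildFlow T (bilinearRHS B C)),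
        IsZeroUGAS (mildFlow T (bilinearRHS B C)),
        T.IsExponentiallyStable,
        (∀ x, IntegrableOn (fun t => ‖T t x‖ ^ 2) (Ioi (0 : ℝ))) ∧
          IsNoncoerciveIISSLyapunov (mildFlow T (bilinearRHS B C)) (logLyapunov T)] := by
  obtain ⟨ξ, hξ, hCξ⟩ := hCξ
  have hfc : IsForwardComplete T (bilinearRHS B C) :=
    T.isForwardComplete (isAdmissibleNonlinearity_bilinearRHS hC)
      (hasLinearGrowth_bilinearRHS hξ hCξ)
  refine ⟨hfc, ?_⟩
  tfae_have 1 → 2 := fun h => h.1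
  tfae_have 2 → 3 := fun h => h.isZeroUGAS
  tfae_have 3 → 4 := isExponentiallyStable_of_isZeroUGAS hfc (bilinearRHS_zero hξ hCξ)
  tfae_have 4 → 1 := fun h => ⟨isIISS_of_isExponentiallyStable hfc hξ hCξ h,
    isISSSmallInputs_of_isExponentiallyStable hfc hξ hCξ h⟩
  tfae_have 4 → 5 := fun h => isNoncoerciveIISSLyapunov_logLyapunov h hfc hC hξ hCξ
  tfae_have 5 → 4 := fun h => h.2.isExponentiallyStable h.1
  tfae_finish
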